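/- \textbf{Notation.} Let $M_N(\mathbb C)_{sa}^m$ be the space of $m$-tuples $x=(x_1,\dots,x_m)$ of self-adjoint $N\times N$ matrices, a Euclidean space with inner product $\sum_j \mathrm{Tr}(x_jy_j)$; Lebesgue measure $dx$, the norm $|\cdot|$ and the gradient $\nabla$ refer to it. Put $\tau_N=\frac1N\mathrm{Tr}$, $\|y\|_2=(\sum_j\tau_N(y_j^*y_j))^{1/2}$ for $y\in M_N(\mathbb C)^m$, $\|x\|_\infty=\max_j\|x_j\|$ (operator norm), and $DV=N\nabla V$. A non-commutative law of an $m$-tuple is a linear, unital, completely positive, tracial functional $\lambda$ on the non-commutative polynomials $\mathbb C\langle X_1,\dots,X_m\rangle$ (with $X_j^*=X_j$); the space $\Sigma_m$ of these laws has the topology of pointwise convergence. The law of $x\in M_N(\mathbb C)_{sa}^m$ is $\lambda_x(p)=\tau_N(p(x))$. An (operator-valued) trace polynomial is an element of $\mathrm{TrP}^1_m=\mathrm{Sym}\big(\mathbb C\langle X\rangle/\mathrm{span}(pq-qp)\big)\otimes\mathbb C\langle X\rangle$, i.e. a linear combination of terms $\tau(p_1)\cdots\tau(p_\ell)\,p_0$;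 it is evaluated at a self-adjoint tuple in a tracial von Neumann algebra by substituting the tuple for $X$ and the trace for $\tau$. A sequence $\phi_N:M_N(\mathbb C)_{sa}^m\to M_N(\mathbb C)^m$ is asymptotically approximable by trace polynomials if for all $\epsilon,R>0$ there is $f\in(\mathrm{TrP}^1_m)^m$ with $\limsup_{N\to\infty}\sup_{\|x\|_\infty\le R}\|\phi_N(x)-f(x)\|_2\le\epsilon$. The classical Fisher information of a probability measure $\mu$ on a Euclidean space is $\mathcal I(\mu)=\int|\Xi|^2d\mu$ if there is $\Xi\in L^2(\mu)$ with $\int f\,\Xi\,d\mu=\int\nabla f\,d\mu$ for all $f\in C_c^\infty$, and $\mathcal I(\mu)=\infty$ otherwise. A tracial von Neumann algebra $(\mathcal M,\tau)$ is a von Neumann algebra $\mathcal M$ of operators on a Hilbert space with a bounded, weak-operator continuous linear functional $\tau$ with $\tau(1)=1$, $\tau(xy)=\tau(yx)$ and $\tau(x^*x)\ge0$. If $\mathcal M$ is generated as a von Neumann algebra by a self-adjoint tuple $X$, the free conjugate variable $J(X)$ is the tuple $\xi\in L^2(\mathcal M,\tau)^m$ with $\tau(\xi_jp(X))=\tau\otimes\tau(\mathcal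 D_jp(X))$ for all non-commutative polynomials $p$ and all $j$, where $\mathcal D_j$ is the free difference quotient $\mathcal D_j[X_{i_1}\cdots X_{i_d}]=\sum_{k:\,i_k=j}X_{i_1}\cdots X_{i_{k-1}}\otimes X_{i_{k+1}}\cdots X_{i_d}$. If $J(X)=\xi$ exists and $X$ has law $\lambda$, then $\Phi^*(\lambda)=\sum_j\tau(\xi_j^2)$ and $\lambda$ is said to have finite free Fisher information; otherwise $\Phi^*(\lambda)=\infty$. \textbf{Proposition.} For each $N$ let $V_N:M_N(\mathbb C)_{sa}^m\to\mathbb R$ be differentiable with $\int e^{-N^2V_N(x)}dx<\infty$, and let $\mu_N$ be the probability measure with density proportional to $e^{-N^2V_N}$. Assume: \begin{enumerate} \item[(A)] $\mu_N$ concentrates around a non-commutative law $\lambda$: $\mu_N(\{x:\lambda_x\in\mathcal U\})\to1$ for every neighborhood $\mathcal U$ of $\lambda$ in $\Sigma_m$. \item[(B)] $\{DV_N\}$ is asymptotically approximable by trace polynomials. \item[(C)] For some integer $n\ge0$ and some $a,b>0$, $\|DV_N(x)\|_2^2\le a+b\sum_{j=1}^m\tau_N(x_j^{2n})$ for all $N$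 and $x$. \item[(D)] For some $R_0>0$ and the same $n$, $\lim_{N\to\infty}\int_{\|x\|_\infty\ge R_0}\big(1+\sum_{j=1}^m\tau_N(x_j^{2n})\big)d\mu_N(x)=0$. \end{enumerate} Then: \begin{enumerate} \item[(1)] $\lambda$ is the law of a tuple $X=(X_1,\dots,X_m)$ of self-adjoint elements of a tracial von Neumann algebra $(\mathcal M,\tau)$, generated by $X$, with $\|X_j\|\le R_0$ for all $j$. \item[(2)] There is a sequence $f^{(k)}\in(\mathrm{TrP}^1_m)^m$ with $\lim_{k\to\infty}\limsup_{N\to\infty}\sup_{\|x\|_\infty\le R_0}\|DV_N(x)-f^{(k)}(x)\|_2=0$. \item[(3)] If $X$ is any self-adjoint tuple with law $\lambda$ generating a tracial von Neumann algebra $(\mathcal M,\tau)$, and $\{f^{(k)}\}$ is any sequence as in (2), then $f^{(k)}(X)$ converges in $L^2(\mathcal M,\tau)^m$ and its limit is the conjugate variable $J(X)$; in particular $\Phi^*(\lambda)=\sum_j\|J(X)_j\|_2^2$. \item[(4)] $\lambda$ has finite free Fisher information and $N^{-3}\mathcal I(\mu_N)\to\Phi^*(\lambda)$ as $N\to\infty$.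 \end{enumerate} -/

import Mathlib

open MeasureTheory Filter Topology
open scoped ENNReal ContDiff TensorProduct ComplexOrder

noncomputable section

namespace FreeFisher

/-! ### Non-commutative polynomials and non-commutative laws -/

/-- The algebra `ℂ⟨X₁, …, X_m⟩` of non-commutative polynomials. -/
abbrev NCP (m : ℕ) : Type := MonoidAlgebra ℂ (FreeMonoid (Fin m))

namespace NCP

variable {m : ℕ}

/-- The monomial `X_{i₁} ⋯ X_{i_n}` attached to a word. -/
def mono (w : FreeMonoid (Fin m)) : NCP m := MonoidAlgebra.of ℂ (FreeMonoid (Fin m)) w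

/-- The conjugate-linear involution of `ℂ⟨X₁, …, X_m⟩` with `X_j^* = X_j`: coefficients are
conjugated and words are reversed. -/
def conj (p : NCP m) : NCP m :=
  p.coeff.sum fun w c => MonoidAlgebra.single (star w) (star c)

/-- The evaluation `p ↦ p(x)` at a tuple of elements of a complex algebra. -/
def eval {A : Type*} [Ring A] [Algebra ℂ A] (x : Fin m → A) : NCP m →ₐ[ℂ] A :=
  MonoidAlgebra.lift ℂ A (FreeMonoid (Fin m)) (FreeMonoid.lift x)

/-- The free difference quotient of a word:
`𝒟_j[X_{i₁} ⋯ X_{i_n}] = ∑_{k : i_k = j} X_{i₁} ⋯ X_{i_{k-1}} ⊗ X_{i_{k+1}} ⋯ X_{i_n}`. -/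
def diffWord (j : Fin m) (w : FreeMonoid (Fin m)) : NCP m ⊗[ℂ] NCP m :=
  ∑ k : Fin w.toList.length, if w.toList.get k = j then
    mono (FreeMonoid.ofList (w.toList.take k)) ⊗ₜ[ℂ]
      mono (FreeMonoid.ofList (w.toList.drop (k + 1)))
  else 0

/-- The free difference quotient `𝒟_j : ℂ⟨X⟩ → ℂ⟨X⟩ ⊗ ℂ⟨X⟩`, the linear extension of
`diffWord`. -/
def diff (j : Fin m) : NCP m →ₗ[ℂ] NCP m ⊗[ℂ] NCP m :=
  Finsupp.linearCombination ℂ (diffWord j) ∘ₗ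
    (MonoidAlgebra.coeffLinearEquiv ℂ).toLinearMap

/-- `φ ⊗ φ : ℂ⟨X⟩ ⊗ ℂ⟨X⟩ → ℂ` for a linear functional `φ`. -/
def tensorSq (φ : NCP m →ₗ[ℂ] ℂ) : NCP m ⊗[ℂ] NCP m →ₗ[ℂ] ℂ :=
  LinearMap.mul' ℂ ℂ ∘ₗ TensorProduct.map φ φ

end NCP

/-- A non-commutative law of an `m`-tuple: a linear, unital, completely positive, tracial
functional on `ℂ⟨X₁, …, X_m⟩`. This is the space `Σ_m`. -/
structure NCLaw (m : ℕ) where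
  toFun : NCP m →ₗ[ℂ] ℂ
  map_one : toFun 1 = 1
  completelyPositive : ∀ (k l : ℕ) (P : Matrix (Fin k) (Fin l) (NCP m)),
    (Matrix.of fun i j : Fin l => toFun (∑ r : Fin k, NCP.conj (P r i) * P r j)).PosSemidef
  tracial : ∀ p q : NCP m, toFun (p * q) = toFun (q * p)

/-- The topology of pointwise convergence on `ℂ⟨X₁, …, X_m⟩`. -/
instance (m : ℕ) : TopologicalSpace (NCLaw m) :=
  TopologicalSpace.induced (fun (ν : NCLaw m) (p : NCP m) => ν.toFun p) inferInstance

/-! ### Trace polynomials -/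

/-- The span of the commutators `pq - qp` in `ℂ⟨X₁, …, X_m⟩`. -/
def commutatorSpan (m : ℕ) : Submodule ℂ (NCP m) :=
  Submodule.span ℂ {c | ∃ p q : NCP m, c = p * q - q * p}

/-- Scalar-valued trace polynomials `TrP_m⁰`: the symmetric algebra of
`ℂ⟨X⟩ / span(pq - qp)`; the class of `p` stands for the formal symbol `τ(p)`. -/
abbrev TrP0 (m : ℕ) : Type := SymmetricAlgebra ℂ (NCP m ⧸ commutatorSpan m)

/-- Operator-valued trace polynomials `TrP_m¹ = TrP_m⁰ ⊗ ℂ⟨X⟩`. -/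
abbrev TrP1 (m : ℕ) : Type := TrP0 m ⊗[ℂ] NCP m

section Evaluation

variable {m : ℕ} {A : Type*} [Ring A] [Algebra ℂ A] (tr : A →ₗ[ℂ] ℂ)
  (htr : ∀ a b, tr (a * b) = tr (b * a)) (x : Fin m → A)

/-- The functional `[p] ↦ tr(p(x))` on `ℂ⟨X⟩ / span(pq - qp)`. -/
def evalClass : (NCP m ⧸ commutatorSpan m) →ₗ[ℂ] ℂ :=
  (commutatorSpan m).liftQ (tr ∘ₗ (NCP.eval x).toLinearMap) (by
    refine Submodule.span_le.2 ?_
    rintro _ ⟨p, q, rfl⟩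
    simp [htr (NCP.eval x p) (NCP.eval x q)])

/-- Evaluation of a scalar-valued trace polynomial: `τ(p₁) ⋯ τ(p_n) ↦ tr(p₁(x)) ⋯ tr(p_n(x))`. -/
def TrP0.eval : TrP0 m →ₐ[ℂ] ℂ := SymmetricAlgebra.lift (evalClass tr htr x)

/-- Evaluation of an operator-valued trace polynomial:
`τ(p₁) ⋯ τ(p_n) p₀ ↦ tr(p₁(x)) ⋯ tr(p_n(x)) p₀(x)`. -/
def TrP1.eval : TrP1 m →ₗ[ℂ] A :=
  TensorProduct.lift (((LinearMap.lsmul ℂ A).comp (TrP0.eval tr htr x).toLinearMap).compl₂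
    (NCP.eval x).toLinearMap)

theorem TrP1.eval_tmul (f : TrP0 m) (p : NCP m) :
    TrP1.eval tr htr x (f ⊗ₜ p) = TrP0.eval tr htr x f • NCP.eval x p := rfl

end Evaluation

/-! ### The Euclidean space of tuples of self-adjoint matrices -/

/-- The space `M_N(ℂ)_sa` of self-adjoint matrices, to be equipped with the real inner product
`⟨x, y⟩ = Tr(xy)`. -/
def SAMat (N : ℕ) : Type := selfAdjoint (Matrix (Fin N) (Fin N) ℂ)

namespace SAMat

variable {N : ℕ}

instance : AddCommGroup (SAMat N) :=
  inferInstanceAs (AddCommGroup (selfAdjoint (Matrix (Fin N) (Fin N) ℂ)))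

instance : Module ℝ (SAMat N) :=
  inferInstanceAs (Module ℝ (selfAdjoint (Matrix (Fin N) (Fin N) ℂ)))

/-- The underlying matrix. -/
def toMatrix : SAMat N →ₗ[ℝ] Matrix (Fin N) (Fin N) ℂ where
  toFun x := x.1
  map_add' _ _ := rfl
  map_smul' _ _ := rfl

theorem toMatrix_injective : Function.Injective (toMatrix (N := N)) :=
  fun _ _ h => Subtype.ext h

theorem toMatrix_conjTranspose (x : SAMat N) : (toMatrix x).conjTranspose = toMatrix x := x.2

theorem trace_mul_self (x : SAMat N) :
    (Matrix.trace (toMatrix x * toMatrix x)).re = ∑ i, ∑ j, ‖toMatrix x i j‖ ^ 2 := by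
  have h : ∀ i j, toMatrix x j i = star (toMatrix x i j) := fun i j => by
    conv_lhs => rw [← toMatrix_conjTranspose x]
    rfl
  simp only [Matrix.trace, Matrix.diag, Matrix.mul_apply, Complex.re_sum]
  refine Finset.sum_congr rfl fun i _ => Finset.sum_congr rfl fun j _ => ?_
  rw [h i j, Complex.star_def, Complex.mul_conj, Complex.normSq_eq_norm_sq, Complex.ofReal_re]

/-- The inner product `⟨x, y⟩ = Tr(xy)`. -/
abbrev core (N : ℕ) : InnerProductSpace.Core ℝ (SAMat N) where
  inner x y := (Matrix.trace (toMatrix x * toMatrix y)).re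
  conj_inner_symm x y := by
    simp [Matrix.trace_mul_comm (toMatrix y) (toMatrix x)]
  re_inner_nonneg x := by
    change 0 ≤ (Matrix.trace (toMatrix x * toMatrix x)).re
    rw [trace_mul_self]
    positivity
  add_left x y z := by simp [add_mul]
  smul_left x y r := by simp
  definite x h := by
    change (Matrix.trace (toMatrix x * toMatrix x)).re = 0 at h
    rw [trace_mul_self] at h
    apply toMatrix_injective
    ext i j
    rw [Finset.sum_eq_zero_iff_of_nonneg (fun i _ => by positivity)] at h
    have h1 := h i (Finset.mem_univ _)
    rw [Finset.sum_eq_zero_iff_of_nonneg (fun i _ => by positivity)] at h1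
    have h2 := h1 j (Finset.mem_univ _)
    simpa using h2

instance : NormedAddCommGroup (SAMat N) :=
  InnerProductSpace.Core.toNormedAddCommGroup (cd := core N)

instance : InnerProductSpace ℝ (SAMat N) := InnerProductSpace.ofCore (core N).toCore

theorem inner_def (x y : SAMat N) :
    inner ℝ x y = (Matrix.trace (toMatrix x * toMatrix y)).re := rfl

instance : FiniteDimensional ℝ (SAMat N) :=
  have : FiniteDimensional ℝ (Matrix (Fin N) (Fin N) ℂ) :=
    inferInstanceAs (FiniteDimensional ℝ (Fin N → Fin N → ℂ))
  FiniteDimensional.of_injective toMatrix toMatrix_injective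

instance : CompleteSpace (SAMat N) := FiniteDimensional.complete ℝ _

instance : MeasurableSpace (SAMat N) := borel _

instance : BorelSpace (SAMat N) := ⟨rfl⟩

end SAMat

/-- The Euclidean space `M_N(ℂ)_sa^m` with inner product `∑_j Tr(x_j y_j)`. Gradients and
Lebesgue measure (`volume`) are those of this inner product. -/
abbrev MatTuple (m N : ℕ) : Type := PiLp 2 fun _ : Fin m => SAMat N

/-- The normalized trace `τ_N = (1/N) Tr` on `M_N(ℂ)`. -/
def tauN (N : ℕ) : Matrix (Fin N) (Fin N) ℂ →ₗ[ℂ] ℂ :=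
  (N : ℂ)⁻¹ • Matrix.traceLinearMap (Fin N) ℂ ℂ

theorem tauN_mul_comm (N : ℕ) (a b : Matrix (Fin N) (Fin N) ℂ) :
    tauN N (a * b) = tauN N (b * a) := by
  simp [tauN, Matrix.trace_mul_comm a b]

namespace MatTuple

variable {m N : ℕ}

/-- A tuple of self-adjoint matrices as a tuple of matrices. -/
def mat (x : MatTuple m N) : Fin m → Matrix (Fin N) (Fin N) ℂ := fun j => SAMat.toMatrix (x j)

/-- `‖x‖_∞ = max_j ‖x_j‖`, the largest of the operator norms on `ℂ^N` with the Euclidean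
norm. -/
def opNorm (x : MatTuple m N) : ℝ :=
  ⨆ j, ‖Matrix.toEuclideanCLM (n := Fin N) (𝕜 := ℂ) (x.mat j)‖

/-- `∑_j τ_N(x_j^{2n})`. -/
def evenMoment (n : ℕ) (x : MatTuple m N) : ℝ := ∑ j, (tauN N (x.mat j ^ (2 * n))).re

/-- The value `f(x) ∈ M_N(ℂ)^m` of an `m`-tuple of operator-valued trace polynomials. -/
def evalTrP (f : Fin m → TrP1 m) (x : MatTuple m N) : Fin m → Matrix (Fin N) (Fin N) ℂ :=
  fun j => TrP1.eval (tauN N) (tauN_mul_comm N) x.mat (f j)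

end MatTuple

/-- `‖y‖₂ = (∑_j τ_N(y_j^* y_j))^{1/2}` on `M_N(ℂ)^m`. -/
def norm2 {m N : ℕ} (y : Fin m → Matrix (Fin N) (Fin N) ℂ) : ℝ :=
  √(∑ j, (tauN N ((y j).conjTranspose * y j)).re)

/-- The normalized gradient `DV = N ∇V`. -/
def normGrad {m N : ℕ} (V : MatTuple m N → ℝ) (x : MatTuple m N) :
    Fin m → Matrix (Fin N) (Fin N) ℂ :=
  MatTuple.mat ((N : ℝ) • gradient V x)

/-- `limsup_{N → ∞} sup_{‖x‖_∞ ≤ R} ‖φ_N(x) - f(x)‖₂`, as an extended nonnegative number. -/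
def approxError {m : ℕ} (φ : ∀ N, MatTuple m N → Fin m → Matrix (Fin N) (Fin N) ℂ)
    (f : Fin m → TrP1 m) (R : ℝ) : ℝ≥0∞ :=
  limsup (fun N => ⨆ (x : MatTuple m N) (_ : x.opNorm ≤ R),
    ENNReal.ofReal (norm2 (φ N x - x.evalTrP f))) atTop

/-- Asymptotic approximability by trace polynomials of a sequence
`φ_N : M_N(ℂ)_sa^m → M_N(ℂ)^m`. -/
def AsympApproxByTrP {m : ℕ}
    (φ : ∀ N, MatTuple m N → Fin m → Matrix (Fin N) (Fin N) ℂ) : Prop :=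
  ∀ ε : ℝ, 0 < ε → ∀ R : ℝ, 0 < R →
    ∃ f : Fin m → TrP1 m, approxError φ f R ≤ ENNReal.ofReal ε

/-! ### Random matrix models -/

/-- The probability measure `dμ(x) = Z⁻¹ exp(-N² V(x)) dx` on `M_N(ℂ)_sa^m`. -/
def gibbs {m N : ℕ} (V : MatTuple m N → ℝ) : Measure (MatTuple m N) :=
  (volume : Measure (MatTuple m N)).tilted fun x => -(N : ℝ) ^ 2 * V x

/-- The microstate space `Γ_N(𝒰)`: the tuples `x` whose law `λ_x : p ↦ τ_N(p(x))` lies in `𝒰`. -/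
def microstates {m : ℕ} (N : ℕ) (U : Set (NCLaw m)) : Set (MatTuple m N) :=
  {x | ∃ ν ∈ U, ∀ p, ν.toFun p = tauN N (NCP.eval x.mat p)}

/-- The measures `μ_N` on `M_N(ℂ)_sa^m` concentrate around the non-commutative law `lam`. -/
def ConcentratesAround {m : ℕ} (μ : ∀ N, Measure (MatTuple m N)) (lam : NCLaw m) : Prop :=
  ∀ U ∈ 𝓝 lam, Tendsto (fun N => μ N (microstates N U)) atTop (𝓝 1)

/-! ### Classical Fisher information -/

section Classical

variable {E : Type*} [NormedAddCommGroup E] [InnerProductSpace ℝ E] [FiniteDimensional ℝ E]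
  [MeasurableSpace E] [BorelSpace E]

/-- `Ξ ∈ L²(μ)` is the classical conjugate variable (score function) of the identity random
variable on `(E, μ)`: `E[f Ξ] = E[∇f]` for all `f ∈ C_c^∞(E)`. As a function on `E` it is
automatically a function of the random variable; it is unique up to `μ`-null sets. -/
def IsScore (μ : Measure E) (Ξ : E → E) : Prop :=
  haveI : CompleteSpace E := FiniteDimensional.complete ℝ E
  MemLp Ξ 2 μ ∧ ∀ f : E → ℝ, ContDiff ℝ ∞ f → HasCompactSupport f →
    ∫ x, f x • Ξ x ∂μ = ∫ x, gradient f x ∂μ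

/-- The Fisher information `ℐ(μ) = E[|Ξ|²]`, and `∞` if there is no conjugate variable. -/
def fisherInfo (μ : Measure E) : ℝ≥0∞ :=
  ⨅ (Ξ : E → E) (_ : IsScore μ Ξ), ∫⁻ x, ‖Ξ x‖ₑ ^ 2 ∂μ

end Classical

/-! ### Tracial von Neumann algebras -/

section VonNeumann

variable {H : Type*} [NormedAddCommGroup H] [InnerProductSpace ℂ H] [CompleteSpace H]

/-- A trace on a von Neumann algebra `M ⊆ B(H)`: a bounded linear functional, continuous for the
weak operator topology, with `τ(1) = 1`, `τ(xy) = τ(yx)` and `τ(x^*x) ≥ 0`. -/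
structure VNTrace (M : VonNeumannAlgebra H) where
  toFun : M.toStarSubalgebra →ₗ[ℂ] ℂ
  bounded : ∃ C : ℝ, ∀ a, ‖toFun a‖ ≤ C * ‖a‖
  wot_continuous : @Continuous M.toStarSubalgebra ℂ
    (TopologicalSpace.induced
      (fun a => (ContinuousLinearMapWOT.ofCLM (a : H →L[ℂ] H) : H →WOT[ℂ] H)) inferInstance)
    inferInstance toFun
  map_one : toFun 1 = 1
  tracial : ∀ a b, toFun (a * b) = toFun (b * a)
  nonneg : ∀ a, 0 ≤ toFun (star a * a)

namespace VNTrace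

variable {M : VonNeumannAlgebra H} (τ : VNTrace M)

theorem conj_star_mul (a b : M.toStarSubalgebra) :
    (starRingEnd ℂ) (τ.toFun (star b * a)) = τ.toFun (star a * b) := by
  have him : ∀ c, (τ.toFun (star c * c)).im = 0 := fun c => (Complex.nonneg_iff.1 (τ.nonneg c)).2.symm
  have h1 := him (a + b)
  have h2 := him (a + Complex.I • b)
  simp only [star_add, star_smul, add_mul, mul_add, smul_mul_assoc, mul_smul_comm, map_add,
    map_smul, Complex.add_im, him, smul_eq_mul, Complex.star_def, Complex.conj_I, Complex.mul_im,
    Complex.neg_im, Complex.neg_re, Complex.I_re, Complex.I_im, Complex.mul_re] at h1 h2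
  apply Complex.ext
  · simp only [Complex.conj_re]; linarith
  · simp only [Complex.conj_im]; linarith

set_option linter.unusedVariables false in
/-- The algebra `M` regarded as a space with the semi-inner product `⟨a, b⟩ = τ(a^*b)`. -/
@[nolint unusedArguments]
def PreL2 (τ : VNTrace M) : Type _ := M.toStarSubalgebra

instance : AddCommGroup τ.PreL2 := inferInstanceAs (AddCommGroup M.toStarSubalgebra)

instance : Module ℂ τ.PreL2 := inferInstanceAs (Module ℂ M.toStarSubalgebra)

/-- The identity map from `M` to `PreL2`. -/
def toPreL2 : M.toStarSubalgebra ≃ₗ[ℂ] τ.PreL2 := LinearEquiv.refl ℂ _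

/-- The semi-inner product `⟨a, b⟩ = τ(a^*b)`. -/
abbrev preCore : PreInnerProductSpace.Core ℂ τ.PreL2 where
  inner a b := τ.toFun (star (τ.toPreL2.symm a) * τ.toPreL2.symm b)
  conj_inner_symm a b := τ.conj_star_mul _ _
  re_inner_nonneg a := (Complex.nonneg_iff.1 (τ.nonneg (τ.toPreL2.symm a))).1
  add_left a b c := by simp [add_mul]
  smul_left a b r := by simp

instance : SeminormedAddCommGroup τ.PreL2 :=
  InnerProductSpace.Core.toSeminormedAddCommGroup (c := τ.preCore)

instance : InnerProductSpace ℂ τ.PreL2 := InnerProductSpace.ofCore τ.preCore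

/-- The Hilbert space `L²(M, τ)`: the completion of `M` for `‖a‖₂ = τ(a^*a)^{1/2}`. -/
abbrev L2 : Type _ := UniformSpace.Completion τ.PreL2

/-- The canonical map `M → L²(M, τ)`. -/
def toL2 (a : M.toStarSubalgebra) : τ.L2 := ((τ.toPreL2 a : τ.PreL2) : τ.L2)

/-- `τ(ξ a)` for `ξ ∈ L²(M, τ)` and `a ∈ M`, that is `⟨a^*, ξ⟩`: the continuous extension of
`b ↦ τ(b a) = τ(a b)` from `M` to `L²(M, τ)`. -/
def mulTrace (ξ : τ.L2) (a : M.toStarSubalgebra) : ℂ := inner ℂ (τ.toL2 (star a)) ξ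

theorem mulTrace_toL2 (a b : M.toStarSubalgebra) : τ.mulTrace (τ.toL2 b) a = τ.toFun (b * a) := by
  rw [mulTrace, toL2, toL2, UniformSpace.Completion.inner_coe]
  change τ.toFun (star (star a) * b) = _
  rw [star_star, τ.tracial]

variable {m : ℕ}

/-- The tuple `X` of self-adjoint elements of `(M, τ)` has the non-commutative law `lam`. -/
def HasLaw (X : Fin m → M.toStarSubalgebra) (lam : NCLaw m) : Prop :=
  (∀ j, IsSelfAdjoint (X j)) ∧ ∀ p, τ.toFun (NCP.eval X p) = lam.toFun p

/-- The value `f(X) ∈ M` of an operator-valued trace polynomial. -/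
def evalTrP (X : Fin m → M.toStarSubalgebra) (f : TrP1 m) : M.toStarSubalgebra :=
  TrP1.eval τ.toFun τ.tracial X f

/-- `ξ ∈ L²(M, τ)^m` satisfies the defining relation of the free conjugate variable of `X`:
`τ(ξ_j p(X)) = τ ⊗ τ(𝒟_j p(X))` for every non-commutative polynomial `p`. (It is used for tuples
`X` that generate `M`, where it determines `ξ`.) -/
def IsConjugateVariable (X : Fin m → M.toStarSubalgebra) (ξ : Fin m → τ.L2) : Prop :=
  ∀ (j : Fin m) (p : NCP m), τ.mulTrace (ξ j) (NCP.eval X p) =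
    NCP.tensorSq (τ.toFun ∘ₗ (NCP.eval X).toLinearMap) (NCP.diff j p)

end VNTrace

/-- `M` is generated by the tuple `X` as a von Neumann algebra. -/
def Generates {M : VonNeumannAlgebra H} {m : ℕ} (X : Fin m → M.toStarSubalgebra) : Prop :=
  ∀ S : VonNeumannAlgebra H, (∀ j, (X j : H →L[ℂ] H) ∈ S) → M ≤ S

end VonNeumann

/-- The free Fisher information `Φ^*(lam) = ∑_j τ(ξ_j²)`, where `ξ` is the conjugate variable of a
generating tuple `X` with law `lam`, and `∞` if there is no conjugate variable. (The components
of `ξ` are self-adjoint, so `τ(ξ_j²) = ‖ξ_j‖₂²`; the number depends neither on the realization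
`X` nor on `ξ`, so that the infimum is over at most one value.) -/
def freeFisherInfo {m : ℕ} (lam : NCLaw m) : ℝ≥0∞ :=
  sInf {r | ∃ (H : Type) (_ : NormedAddCommGroup H) (_ : InnerProductSpace ℂ H)
    (_ : CompleteSpace H) (M : VonNeumannAlgebra H) (τ : VNTrace M)
    (X : Fin m → M.toStarSubalgebra) (ξ : Fin m → τ.L2),
    τ.HasLaw X lam ∧ Generates X ∧ τ.IsConjugateVariable X ξ ∧
      r = ENNReal.ofReal (∑ j, ‖ξ j‖ ^ 2)}

end FreeFisher

end

/-! The score of μ_N is N²∇V_N, and |N²∇V_N|² = N³‖DV_N‖₂². Hence N⁻³ℐ(μ_N) is the expectation of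
‖DV_N‖₂² as soon as the latter is finite (`fisherInfo_gibbs`), and the task is to identify the limit
of this expectation with ‖J(X)‖₂².

The link with the free side is integration by parts against the field χ(x)p(x) in the j-th
coordinate, with χ a smooth cut-off. Summing Tr(e s(x) e t(x)) over an orthonormal basis of
self-adjoint matrices e gives Tr s(x) · Tr t(x), so the divergence of p(x) is N²(τ_N ⊗ τ_N)(𝒟_j p).
The outcome is a Schwinger–Dyson equation E[χ τ_N((DV_N)_j p)] = E[χ (τ_N ⊗ τ_N)(𝒟_j p)] + O(1/N)
(`norm_integral_cutoff_sub_le`). The error comes from ∇χ; it is small because the operator norm is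
1-Lipschitz for the Euclidean norm, so that |∇χ| ≤ 1 is possible in every dimension.

A trace polynomial depends on the tuple only through an ordinary polynomial whose coefficients are
continuous functions of the law (`TrP1.eval_eq_reduce`, `TrP1.exists_continuous_reduce`). Norms and
pairings of trace polynomials are thus continuous functions of the law, and under concentration
their truncated expectations converge to the values at λ (`tendsto_integral_cutoff`). On ‖x‖_∞ ≤ R₀
the gradient DV_N is close to f^{(k)}; beyond R₀ it is controlled by (C) and (D).

Three consequences follow. At one matrix tuple with law near λ, both f^{(k)} and f^{(l)} are near
DV_N, so f^{(k)}(X) is Cauchy in L² (`normSq_sub_le`). In the limit the Schwinger–Dyson equation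
becomes the conjugate variable relation for the limit ξ (`norm_pairing_sub_tensorSq_le`). Finally
E‖DV_N‖₂² tends to lim ‖f^{(k)}‖₂² = ‖ξ‖₂² (`tendsto_lintegral_norm2_sq`). Since ξ is a limit of
polynomials, every other solution of the relation differs from it by a vector orthogonal to ξ, so ξ
attains the infimum defining Φ^*.

The operators X_j come from the GNS construction: ‖X_j p‖₂ ≤ R₀‖p‖₂ is a closed condition on laws
that holds for matrices of norm less than R₀, and right multiplications show that the vector state
is a trace on the generated von Neumann algebra. -/

namespace FreeFisher

/-! ### Algebra of non-commutative polynomials -/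

namespace NCP

variable {m : ℕ}

/-- The variable `X_j`. -/
noncomputable def var (j : Fin m) : NCP m := mono (FreeMonoid.of j)

theorem induction_mono {P : NCP m → Prop} (p : NCP m) (hm : ∀ w, P (mono w))
    (ha : ∀ p q, P p → P q → P (p + q)) (hs : ∀ (c : ℂ) p, P p → P (c • p)) : P p :=
  MonoidAlgebra.induction_on p hm ha hs

theorem mono_mul (u v : FreeMonoid (Fin m)) : mono (u * v) = mono u * mono v :=
  map_mul (MonoidAlgebra.of ℂ (FreeMonoid (Fin m))) u v

theorem mono_one : mono (1 : FreeMonoid (Fin m)) = 1 :=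
  map_one (MonoidAlgebra.of ℂ (FreeMonoid (Fin m)))

theorem mono_of_mul (j : Fin m) (w : FreeMonoid (Fin m)) :
    mono (FreeMonoid.of j * w) = var j * mono w := mono_mul _ _

theorem induction_var {P : NCP m → Prop} (p : NCP m) (h1 : P 1)
    (hv : ∀ j p, P p → P (var j * p))
    (ha : ∀ p q, P p → P q → P (p + q)) (hs : ∀ (c : ℂ) p, P p → P (c • p)) : P p := by
  refine induction_mono p (fun w => ?_) ha hs
  induction w using FreeMonoid.inductionOn' with
  | one => rw [mono_one]; exact h1
  | of_mul j w ih => rw [mono_of_mul]; exact hv j _ ih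

section Conj

theorem conj_add (p q : NCP m) : conj (p + q) = conj p + conj q := by
  unfold conj
  rw [MonoidAlgebra.coeff_add]
  exact Finsupp.sum_add_index' (by simp) (by simp)

theorem conj_smul (c : ℂ) (p : NCP m) : conj (c • p) = star c • conj p := by
  unfold conj
  rw [MonoidAlgebra.coeff_smul, Finsupp.sum_smul_index' (by simp), Finsupp.smul_sum]
  simp [MonoidAlgebra.smul_single]

theorem conj_mono (w : FreeMonoid (Fin m)) : conj (mono w) = mono (star w) := by
  simp [conj, mono]

theorem conj_one : conj (1 : NCP m) = 1 := by
  rw [← mono_one, conj_mono, star_one]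

theorem conj_conj (p : NCP m) : conj (conj p) = p := by
  induction p using induction_mono with
  | hm w => simp [conj_mono]
  | ha p q hp hq => rw [conj_add, conj_add, hp, hq]
  | hs c p hp => rw [conj_smul, conj_smul, hp, star_star]

theorem conj_mul (p q : NCP m) : conj (p * q) = conj q * conj p := by
  induction p using induction_mono with
  | hm w =>
    induction q using induction_mono with
    | hm v => rw [← mono_mul, conj_mono, conj_mono, conj_mono, star_mul, mono_mul]
    | ha p q hp hq => rw [mul_add, conj_add, conj_add, hp, hq, add_mul]
    | hs c p hp => rw [mul_smul_comm, conj_smul, conj_smul, hp, smul_mul_assoc]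
  | ha p q hp hq => rw [add_mul, conj_add, conj_add, hp, hq, mul_add]
  | hs c p hp => rw [smul_mul_assoc, conj_smul, conj_smul, hp, mul_smul_comm]

theorem conj_var (j : Fin m) : conj (var j) = var j := by
  rw [var, conj_mono, FreeMonoid.star_of]

theorem conj_sum {ι : Type*} (s : Finset ι) (f : ι → NCP m) :
    conj (∑ i ∈ s, f i) = ∑ i ∈ s, conj (f i) :=
  map_sum (AddMonoidHom.mk' conj conj_add) f s

end Conj

section Eval

variable {A : Type*} [Ring A] [Algebra ℂ A]

theorem eval_mono (x : Fin m → A) (w : FreeMonoid (Fin m)) :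
    eval x (mono w) = FreeMonoid.lift x w := by
  simp [eval, mono]

theorem eval_var (x : Fin m → A) (j : Fin m) : eval x (var j) = x j := by
  rw [var, eval_mono, FreeMonoid.lift_eval_of]

theorem eval_conj [StarRing A] [StarModule ℂ A] {x : Fin m → A} (hx : ∀ j, star (x j) = x j)
    (p : NCP m) : eval x (conj p) = star (eval x p) := by
  induction p using induction_var with
  | h1 => simp [conj_one]
  | hv j p hp => rw [conj_mul, map_mul, map_mul, star_mul, hp, conj_var, eval_var, hx]
  | ha p q hp hq => rw [conj_add, map_add, map_add, hp, hq, star_add]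
  | hs c p hp => rw [conj_smul, map_smul, map_smul, hp, star_smul]

theorem eval_var_self (p : NCP m) : eval var p = p := by
  induction p using induction_var with
  | h1 => simp
  | hv j p hp => rw [map_mul, hp, eval_var]
  | ha p q hp hq => rw [map_add, hp, hq]
  | hs c p hp => rw [map_smul, hp]

end Eval

end NCP

/-! ### Reduction of trace polynomials -/

section Reduce

variable {m : ℕ}

/-- The polynomial obtained from a trace polynomial by substituting the numbers `φ(p)` for the
symbols `τ(p)`. -/
noncomputable def TrP1.reduce (φ : NCP m →ₗ[ℂ] ℂ) (hφ : ∀ p q, φ (p * q) = φ (q * p)) (f : TrP1 m) :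
    NCP m := TrP1.eval φ hφ NCP.var f

variable {A : Type*} [Ring A] [Algebra ℂ A] (tr : A →ₗ[ℂ] ℂ)
  (htr : ∀ a b, tr (a * b) = tr (b * a)) (x : Fin m → A)

/-- The symbols τ(p) see the algebra only through the law, so any tracial algebra may be replaced by
the free algebra carrying φ as its trace, with the variables themselves as the tuple. -/
theorem TrP0.eval_congr {φ : NCP m →ₗ[ℂ] ℂ} (hφ : ∀ p q, φ (p * q) = φ (q * p))
    (h : ∀ p, tr (NCP.eval x p) = φ p) (s : TrP0 m) :
    TrP0.eval tr htr x s = TrP0.eval φ hφ NCP.var s := by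
  have : evalClass tr htr x = evalClass φ hφ NCP.var := by
    refine Submodule.linearMap_qext _ (LinearMap.ext fun p => ?_)
    change tr (NCP.eval x p) = φ (NCP.eval NCP.var p)
    rw [NCP.eval_var_self, h]
  rw [TrP0.eval, TrP0.eval, this]

/-- Matrices and operators are compared only through this identity: at a tuple with law φ, a trace
polynomial is an ordinary polynomial determined by φ. -/
theorem TrP1.eval_eq_reduce {φ : NCP m →ₗ[ℂ] ℂ} (hφ : ∀ p q, φ (p * q) = φ (q * p))
    (h : ∀ p, tr (NCP.eval x p) = φ p) (f : TrP1 m) :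
    TrP1.eval tr htr x f = NCP.eval x (TrP1.reduce φ hφ f) := by
  induction f using TensorProduct.induction_on with
  | zero => simp [TrP1.reduce]
  | tmul s p =>
    rw [TrP1.reduce, TrP1.eval_tmul, TrP1.eval_tmul, TrP0.eval_congr tr htr x hφ h,
      NCP.eval_var_self, map_smul]
  | add f g hf hg =>
    rw [TrP1.reduce] at *
    rw [map_add, map_add, hf, hg, map_add]

/-- The function c lives on the product space of all functions `NCP m → ℂ`, not on `NCLaw m`. It can
then be applied to every matrix law, including the non-unital one at N = 0, and compactness of
products of discs is available. -/
theorem TrP0.exists_continuous_eval (s : TrP0 m) : ∃ c : (NCP m → ℂ) → ℂ, Continuous c ∧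
    ∀ (φ : NCP m →ₗ[ℂ] ℂ) (hφ : ∀ p q, φ (p * q) = φ (q * p)),
      TrP0.eval φ hφ NCP.var s = c φ := by
  induction s using SymmetricAlgebra.induction with
  | algebraMap r => exact ⟨fun _ => r, continuous_const, fun φ hφ => by simp⟩
  | ι q =>
    obtain ⟨p, rfl⟩ := Submodule.Quotient.mk_surjective _ q
    refine ⟨fun φ => φ p, continuous_apply p, fun φ hφ => ?_⟩
    rw [TrP0.eval, SymmetricAlgebra.lift_ι_apply]
    change φ (NCP.eval NCP.var p) = φ p
    rw [NCP.eval_var_self]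
  | mul s t hs ht =>
    obtain ⟨c, hc, hc'⟩ := hs
    obtain ⟨d, hd, hd'⟩ := ht
    exact ⟨fun φ => c φ * d φ, hc.mul hd, fun φ hφ => by rw [map_mul, hc', hd']⟩
  | add s t hs ht =>
    obtain ⟨c, hc, hc'⟩ := hs
    obtain ⟨d, hd, hd'⟩ := ht
    exact ⟨fun φ => c φ + d φ, hc.add hd, fun φ hφ => by rw [map_add, hc', hd']⟩

theorem TrP1.exists_continuous_reduce (f : TrP1 m) :
    ∃ (n : ℕ) (c : Fin n → (NCP m → ℂ) → ℂ) (p : Fin n → NCP m), (∀ i, Continuous (c i)) ∧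
    ∀ (φ : NCP m →ₗ[ℂ] ℂ) (hφ : ∀ p q, φ (p * q) = φ (q * p)),
      TrP1.reduce φ hφ f = ∑ i, c i φ • p i := by
  induction f using TensorProduct.induction_on with
  | zero => exact ⟨0, fun _ _ => 0, fun _ => 0, by simp, by simp [TrP1.reduce]⟩
  | tmul s p =>
    obtain ⟨c, hc, hc'⟩ := TrP0.exists_continuous_eval s
    refine ⟨1, fun _ => c, fun _ => p, fun _ => hc, fun φ hφ => ?_⟩
    rw [TrP1.reduce, TrP1.eval_tmul, hc', NCP.eval_var_self]
    simp
  | add f g hf hg =>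
    obtain ⟨n, c, p, hc, h⟩ := hf
    obtain ⟨k, d, q, hd, h'⟩ := hg
    refine ⟨n + k, Fin.append c d, Fin.append p q, fun i => ?_, fun φ hφ => ?_⟩
    · induction i using Fin.addCases with
      | left i => simpa using hc i
      | right i => simpa using hd i
    · have := h φ hφ
      have := h' φ hφ
      rw [TrP1.reduce] at *
      rw [map_add, Fin.sum_univ_add]
      simp_all

/-- `‖f‖₂²` as a continuous function of the law. -/
theorem TrP1.exists_continuous_normSq (f : Fin m → TrP1 m) :
    ∃ G : (NCP m → ℂ) → ℝ, Continuous G ∧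
    ∀ (φ : NCP m →ₗ[ℂ] ℂ) (hφ : ∀ p q, φ (p * q) = φ (q * p)),
      ∑ j, (φ (NCP.conj (TrP1.reduce φ hφ (f j)) * TrP1.reduce φ hφ (f j))).re = G φ := by
  choose n c p hc h using fun j => TrP1.exists_continuous_reduce (f j)
  refine ⟨fun φ => ∑ j, (∑ i, ∑ k, star (c j i φ) * (c j k φ * φ (NCP.conj (p j i) * p j k))).re,
    ?_, fun φ hφ => ?_⟩
  · refine continuous_finsetSum _ fun j _ => Complex.continuous_re.comp ?_
    refine continuous_finsetSum _ fun i _ => continuous_finsetSum _ fun k _ => ?_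
    exact (hc j i).star.mul ((hc j k).mul (continuous_apply _))
  · refine Finset.sum_congr rfl fun j _ => ?_
    rw [h, NCP.conj_sum, Finset.sum_mul_sum, map_sum]
    simp only [map_sum, NCP.conj_smul, smul_mul_assoc, mul_smul_comm, map_smul, smul_eq_mul]
    congr 1
    refine Finset.sum_congr rfl fun i _ => Finset.sum_congr rfl fun k _ => by ring

/-- `τ(f p)` as a continuous function of the law. -/
theorem TrP1.exists_continuous_pairing (f : TrP1 m) (q : NCP m) :
    ∃ G : (NCP m → ℂ) → ℂ, Continuous G ∧
    ∀ (φ : NCP m →ₗ[ℂ] ℂ) (hφ : ∀ p q, φ (p * q) = φ (q * p)),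
      φ (TrP1.reduce φ hφ f * q) = G φ := by
  obtain ⟨n, c, p, hc, h⟩ := TrP1.exists_continuous_reduce f
  refine ⟨fun φ => ∑ i, c i φ * φ (p i * q), ?_, fun φ hφ => ?_⟩
  · exact continuous_finsetSum _ fun i _ => (hc i).mul (continuous_apply _)
  · rw [h, Finset.sum_mul, map_sum]
    simp

/-- `(τ ⊗ τ)(t)` as a continuous function of the law. -/
theorem NCP.exists_continuous_tensorSq (t : NCP m ⊗[ℂ] NCP m) :
    ∃ G : (NCP m → ℂ) → ℂ, Continuous G ∧ ∀ φ : NCP m →ₗ[ℂ] ℂ, NCP.tensorSq φ t = G φ := by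
  induction t using TensorProduct.induction_on with
  | zero => exact ⟨0, continuous_zero, by simp⟩
  | tmul p q =>
    exact ⟨fun φ => φ p * φ q, (continuous_apply p).mul (continuous_apply q), by simp [NCP.tensorSq]⟩
  | add s t hs ht =>
    obtain ⟨c, hc, hc'⟩ := hs
    obtain ⟨d, hd, hd'⟩ := ht
    exact ⟨fun φ => c φ + d φ, hc.add hd, fun φ => by rw [map_add, hc', hd']⟩

end Reduce

/-! ### Free difference quotients -/

namespace NCP

variable {m : ℕ}

theorem diff_mono (j : Fin m) (w : FreeMonoid (Fin m)) : diff j (mono w) = diffWord j w := by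
  simp [diff, mono]

theorem diff_one (j : Fin m) : diff j (1 : NCP m) = 0 := by
  rw [← mono_one, diff_mono, diffWord]
  exact Fin.sum_univ_zero _

/-- Leibniz rule for a leading letter: position 0 contributes 1 ⊗ p when the letters agree, and
every other position acquires the letter on its left factor. This recursion is what the derivative
of matrix evaluation is matched against. -/
theorem diff_var_mul (j i : Fin m) (p : NCP m) :
    diff j (var i * p) = (if i = j then 1 ⊗ₜ p else 0) +
      TensorProduct.map (LinearMap.mulLeft ℂ (var i)) LinearMap.id (diff j p) := by
  induction p using induction_mono with
  | hm w =>
    rw [← mono_of_mul, diff_mono, diff_mono, diffWord, diffWord, map_sum]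
    refine (Fin.sum_univ_succ fun k : Fin (w.toList.length + 1) =>
      if (i :: w.toList).get k = j then
        mono (FreeMonoid.ofList ((i :: w.toList).take k)) ⊗ₜ[ℂ]
          mono (FreeMonoid.ofList ((i :: w.toList).drop (k + 1))) else 0).trans ?_
    congr 1
    · refine Finset.sum_congr rfl fun k _ => ?_
      simp only [Fin.val_succ, List.take_succ_cons, List.drop_succ_cons,
        FreeMonoid.ofList_cons, mono_of_mul]
      by_cases h : w.toList.get k = j
      · rw [if_pos (show (i :: w.toList).get k.succ = j from h), if_pos h]
        simp
      · rw [if_neg (show ¬ (i :: w.toList).get k.succ = j from h), if_neg h, map_zero]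
  | ha p q hp hq =>
    rw [mul_add, map_add, map_add, hp, hq, map_add, TensorProduct.tmul_add]
    split_ifs <;> abel
  | hs c p hp =>
    rw [mul_smul_comm, map_smul, map_smul, hp, map_smul, smul_add, TensorProduct.tmul_smul]
    split_ifs <;> simp

end NCP

/-! ### Norms of matrices -/

section MatrixNorms

open scoped Matrix Matrix.Norms.L2Operator

variable {N : ℕ}

/-- The square of the Hilbert–Schmidt norm. -/
noncomputable def hsSq (A : Matrix (Fin N) (Fin N) ℂ) : ℝ := ∑ i, ∑ j, ‖A i j‖ ^ 2

theorem hsSq_nonneg (A : Matrix (Fin N) (Fin N) ℂ) : 0 ≤ hsSq A := by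
  unfold hsSq; positivity

theorem trace_conjTranspose_mul_self (A : Matrix (Fin N) (Fin N) ℂ) :
    Matrix.trace (Aᴴ * A) = (hsSq A : ℂ) := by
  rw [hsSq, Finset.sum_comm]
  simp only [Matrix.trace, Matrix.diag, Matrix.mul_apply, Matrix.conjTranspose_apply]
  push_cast
  refine Finset.sum_congr rfl fun i _ => Finset.sum_congr rfl fun j _ => ?_
  rw [← Complex.conj_mul']
  rfl

theorem tauN_apply (A : Matrix (Fin N) (Fin N) ℂ) : tauN N A = (N : ℂ)⁻¹ * Matrix.trace A := by
  simp [tauN]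

theorem tauN_conjTranspose_mul_self (A : Matrix (Fin N) (Fin N) ℂ) :
    tauN N (Aᴴ * A) = (((N : ℝ)⁻¹ * hsSq A : ℝ) : ℂ) := by
  rw [tauN_apply, trace_conjTranspose_mul_self]
  push_cast
  rfl

theorem sum_norm_mulVec_sq_le (A : Matrix (Fin N) (Fin N) ℂ) (v : Fin N → ℂ) :
    ∑ i, ‖(A *ᵥ v) i‖ ^ 2 ≤ ‖A‖ ^ 2 * ∑ i, ‖v i‖ ^ 2 := by
  have h := A.l2_opNorm_mulVec (WithLp.toLp 2 v)
  have h2 := pow_le_pow_left₀ (norm_nonneg _) h 2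
  rw [mul_pow, EuclideanSpace.norm_sq_eq, EuclideanSpace.norm_sq_eq] at h2
  exact h2

theorem sum_norm_col_sq_le (A : Matrix (Fin N) (Fin N) ℂ) (j : Fin N) :
    ∑ i, ‖A i j‖ ^ 2 ≤ ‖A‖ ^ 2 := by
  have h := sum_norm_mulVec_sq_le A (Pi.single j 1)
  have h1 : ∑ i, ‖(Pi.single j 1 : Fin N → ℂ) i‖ ^ 2 = 1 := by
    rw [Finset.sum_eq_single j] <;> simp +contextual
  rw [h1] at h
  simpa using h

theorem norm_entry_le (A : Matrix (Fin N) (Fin N) ℂ) (i j : Fin N) : ‖A i j‖ ≤ ‖A‖ := by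
  refine (sq_le_sq₀ (norm_nonneg _) (norm_nonneg A)).1 ?_
  exact (Finset.single_le_sum (f := fun i => ‖A i j‖ ^ 2) (fun _ _ => by positivity)
    (Finset.mem_univ i)).trans (sum_norm_col_sq_le A j)

/-- A acts separately on each column of B. -/
theorem hsSq_mul_le (A B : Matrix (Fin N) (Fin N) ℂ) : hsSq (A * B) ≤ ‖A‖ ^ 2 * hsSq B := by
  unfold hsSq
  rw [Finset.sum_comm, Finset.sum_comm (f := fun i j => ‖B i j‖ ^ 2), Finset.mul_sum]
  exact Finset.sum_le_sum fun j _ => sum_norm_mulVec_sq_le A fun i => B i j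

theorem hsSq_le (A : Matrix (Fin N) (Fin N) ℂ) : hsSq A ≤ N * ‖A‖ ^ 2 := by
  unfold hsSq
  rw [Finset.sum_comm]
  refine (Finset.sum_le_sum fun j _ => sum_norm_col_sq_le A j).trans ?_
  simp

theorem norm_sq_le_hsSq (A : Matrix (Fin N) (Fin N) ℂ) : ‖A‖ ^ 2 ≤ hsSq A := by
  have h : ‖A‖ ≤ √(hsSq A) := by
    rw [Matrix.cstar_norm_def]
    refine ContinuousLinearMap.opNorm_le_bound _ (Real.sqrt_nonneg _) fun v => ?_
    rw [EuclideanSpace.norm_eq, EuclideanSpace.norm_eq, ← Real.sqrt_mul (hsSq_nonneg A)]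
    refine Real.sqrt_le_sqrt ?_
    rw [hsSq, Finset.sum_mul]
    refine Finset.sum_le_sum fun i _ => ?_
    rw [Matrix.ofLp_toEuclideanCLM]
    refine (pow_le_pow_left₀ (norm_nonneg _)
      (norm_sum_le Finset.univ fun j => A i j * v.ofLp j) 2).trans ?_
    simp only [norm_mul]
    exact Finset.sum_mul_sq_le_sq_mul_sq _ _ _
  calc ‖A‖ ^ 2 ≤ √(hsSq A) ^ 2 := pow_le_pow_left₀ (norm_nonneg _) h 2
    _ = hsSq A := Real.sq_sqrt (hsSq_nonneg A)

theorem norm_tauN_le (A : Matrix (Fin N) (Fin N) ℂ) : ‖tauN N A‖ ≤ ‖A‖ := by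
  rw [tauN_apply, norm_mul, norm_inv, Complex.norm_natCast, Matrix.trace]
  rcases Nat.eq_zero_or_pos N with rfl | hN
  · simp
  rw [inv_mul_le_iff₀ (by positivity)]
  refine (norm_sum_le _ _).trans ((Finset.sum_le_sum fun i _ => norm_entry_le A i i).trans ?_)
  simp

theorem norm_trace_mul_le (A B : Matrix (Fin N) (Fin N) ℂ) :
    ‖Matrix.trace (A * B)‖ ≤ √(hsSq A) * √(hsSq B) := by
  have h : Matrix.trace (A * B) = ∑ p : Fin N × Fin N, A p.1 p.2 * B p.2 p.1 := by
    simp [Matrix.trace, Matrix.mul_apply, Fintype.sum_prod_type]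
  have hA : hsSq A = ∑ p : Fin N × Fin N, ‖A p.1 p.2‖ ^ 2 := by
    rw [Fintype.sum_prod_type]; rfl
  have hB : hsSq B = ∑ p : Fin N × Fin N, ‖B p.2 p.1‖ ^ 2 := by
    rw [Fintype.sum_prod_type, Finset.sum_comm]; rfl
  rw [h, hA, hB]
  refine (norm_sum_le _ _).trans ?_
  simp only [norm_mul]
  exact Real.sum_mul_le_sqrt_mul_sqrt _ _ _

/-- Cauchy–Schwarz for the trace; the factor √N in the Hilbert–Schmidt bound for B cancels against
the normalization, so the constant does not depend on N. -/
theorem norm_tauN_mul_le (A B : Matrix (Fin N) (Fin N) ℂ) :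
    ‖tauN N (A * B)‖ ≤ √((tauN N (Aᴴ * A)).re) * ‖B‖ := by
  rw [tauN_conjTranspose_mul_self, Complex.ofReal_re, tauN_apply, norm_mul, norm_inv,
    Complex.norm_natCast]
  rcases Nat.eq_zero_or_pos N with rfl | hN
  · simp
  have hN' : (0 : ℝ) < N := by exact_mod_cast hN
  have h1 : √(hsSq B) ≤ √N * ‖B‖ := by
    rw [← Real.sqrt_sq (norm_nonneg B), ← Real.sqrt_mul hN'.le]
    exact Real.sqrt_le_sqrt (hsSq_le B)
  have h2 : √((N : ℝ)⁻¹ * hsSq A) = (N : ℝ)⁻¹ * (√N * √(hsSq A)) := by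
    rw [Real.sqrt_mul (by positivity), Real.sqrt_inv]
    have : √(N : ℝ) * √N = N := Real.mul_self_sqrt hN'.le
    have h3 : (0 : ℝ) < √N := Real.sqrt_pos.2 hN'
    field_simp
    rw [pow_two, this, mul_comm]
  rw [h2]
  calc (N : ℝ)⁻¹ * ‖Matrix.trace (A * B)‖ ≤ (N : ℝ)⁻¹ * (√(hsSq A) * (√N * ‖B‖)) := by
        gcongr
        exact (norm_trace_mul_le A B).trans (by gcongr)
    _ = _ := by ring

end MatrixNorms

/-! ### The norm `‖y‖₂` -/

section Norm2

open scoped Matrix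

variable {m N : ℕ}

/-- The tuple `y` as a vector of a Euclidean space whose norm is `‖y‖₂`. -/
noncomputable def norm2Vec (y : Fin m → Matrix (Fin N) (Fin N) ℂ) :
    EuclideanSpace ℂ (Fin m × Fin N × Fin N) :=
  WithLp.toLp 2 fun p => ((√((N : ℝ)⁻¹) : ℝ) : ℂ) * y p.1 p.2.1 p.2.2

theorem norm2_eq_norm (y : Fin m → Matrix (Fin N) (Fin N) ℂ) : norm2 y = ‖norm2Vec y‖ := by
  rw [norm2, EuclideanSpace.norm_eq]
  congr 1
  rw [Fintype.sum_prod_type]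
  refine Finset.sum_congr rfl fun j _ => ?_
  rw [tauN_conjTranspose_mul_self, Complex.ofReal_re, hsSq, Fintype.sum_prod_type, Finset.mul_sum]
  refine Finset.sum_congr rfl fun a _ => ?_
  rw [Finset.mul_sum]
  refine Finset.sum_congr rfl fun b _ => ?_
  rw [norm2Vec, norm_mul, mul_pow, Complex.norm_real, Real.norm_eq_abs, sq_abs,
    Real.sq_sqrt (by positivity)]

theorem norm2Vec_sub (y z : Fin m → Matrix (Fin N) (Fin N) ℂ) :
    norm2Vec (y - z) = norm2Vec y - norm2Vec z := by
  ext p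
  simp [norm2Vec, mul_sub]

theorem norm2_nonneg (y : Fin m → Matrix (Fin N) (Fin N) ℂ) : 0 ≤ norm2 y := Real.sqrt_nonneg _

theorem norm2_sub_le (y z w : Fin m → Matrix (Fin N) (Fin N) ℂ) :
    norm2 (y - z) ≤ norm2 (w - y) + norm2 (w - z) := by
  simp only [norm2_eq_norm, norm2Vec_sub]
  rw [← norm_neg (norm2Vec w - norm2Vec y), neg_sub]
  exact norm_sub_le_norm_sub_add_norm_sub _ _ _

theorem abs_norm2_sub_norm2_le (y z : Fin m → Matrix (Fin N) (Fin N) ℂ) :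
    |norm2 y - norm2 z| ≤ norm2 (y - z) := by
  simp only [norm2_eq_norm, norm2Vec_sub]
  exact abs_norm_sub_norm_le _ _

theorem norm2_sq (y : Fin m → Matrix (Fin N) (Fin N) ℂ) :
    norm2 y ^ 2 = ∑ j, (tauN N ((y j)ᴴ * y j)).re := by
  refine Real.sq_sqrt (Finset.sum_nonneg fun j _ => ?_)
  rw [tauN_conjTranspose_mul_self, Complex.ofReal_re]
  have := hsSq_nonneg (y j)
  positivity

theorem sqrt_tauN_le_norm2 (y : Fin m → Matrix (Fin N) (Fin N) ℂ) (j : Fin m) :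
    √((tauN N ((y j)ᴴ * y j)).re) ≤ norm2 y := by
  refine Real.sqrt_le_sqrt
    (Finset.single_le_sum (f := fun j => (tauN N ((y j)ᴴ * y j)).re) (fun j _ => ?_)
      (Finset.mem_univ j))
  rw [tauN_conjTranspose_mul_self, Complex.ofReal_re]
  have := hsSq_nonneg (y j)
  positivity

theorem norm2_mat_sq (x : MatTuple m N) : norm2 x.mat ^ 2 = (N : ℝ)⁻¹ * ‖x‖ ^ 2 := by
  rw [norm2_sq, PiLp.norm_sq_eq_of_L2, Finset.mul_sum]
  refine Finset.sum_congr rfl fun j _ => ?_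
  rw [tauN_conjTranspose_mul_self, Complex.ofReal_re, ← real_inner_self_eq_norm_sq,
    SAMat.inner_def, SAMat.trace_mul_self]
  rfl

end Norm2

/-! ### The operator norm and the law of a tuple -/

namespace MatTuple

open scoped Matrix Matrix.Norms.L2Operator

variable {m N : ℕ}

theorem star_mat (x : MatTuple m N) (j : Fin m) : star (x.mat j) = x.mat j :=
  SAMat.toMatrix_conjTranspose (x j)

theorem norm_mat_le (x : MatTuple m N) (j : Fin m) : ‖x.mat j‖ ≤ x.opNorm :=
  le_ciSup (f := fun j => ‖Matrix.toEuclideanCLM (n := Fin N) (𝕜 := ℂ) (x.mat j)‖)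
    (Set.finite_range _).bddAbove j

theorem opNorm_nonneg (x : MatTuple m N) : 0 ≤ x.opNorm :=
  Real.iSup_nonneg fun _ => norm_nonneg _

theorem opNorm_le {x : MatTuple m N} {R : ℝ} (hR : 0 ≤ R) (h : ∀ j, ‖x.mat j‖ ≤ R) :
    x.opNorm ≤ R := Real.iSup_le h hR

theorem norm_mat_le_norm (x : MatTuple m N) (j : Fin m) : ‖x.mat j‖ ≤ ‖x‖ := by
  refine le_trans ?_ (PiLp.norm_apply_le x j)
  refine (sq_le_sq₀ (norm_nonneg _) (norm_nonneg _)).1 ((norm_sq_le_hsSq _).trans_eq ?_)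
  rw [← real_inner_self_eq_norm_sq, SAMat.inner_def, SAMat.trace_mul_self]
  rfl

theorem opNorm_le_add (x y : MatTuple m N) : x.opNorm ≤ y.opNorm + ‖x - y‖ := by
  refine opNorm_le (add_nonneg y.opNorm_nonneg (norm_nonneg _)) fun j => ?_
  have h : x.mat j = y.mat j + (x - y).mat j := by
    simp [mat]
  rw [h]
  exact (norm_add_le _ _).trans (add_le_add (norm_mat_le y j) (norm_mat_le_norm _ j))

/-- The operator norm is dominated by the Hilbert–Schmidt norm, so the constant is 1 in every
dimension. The gradient bound for the cut-off functions rests on this. -/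
theorem lipschitzWith_opNorm : LipschitzWith 1 (opNorm : MatTuple m N → ℝ) :=
  LipschitzWith.of_le_add fun x y => by rw [dist_eq_norm]; exact opNorm_le_add x y

theorem continuous_opNorm : Continuous (opNorm : MatTuple m N → ℝ) :=
  lipschitzWith_opNorm.continuous

theorem norm_sq_le_opNorm (x : MatTuple m N) : ‖x‖ ^ 2 ≤ m * (N * x.opNorm ^ 2) := by
  rw [PiLp.norm_sq_eq_of_L2]
  refine (Finset.sum_le_card_nsmul _ _ (N * x.opNorm ^ 2) fun j _ => ?_).trans_eq (by simp)
  rw [← real_inner_self_eq_norm_sq, SAMat.inner_def, SAMat.trace_mul_self]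
  refine (hsSq_le (x.mat j)).trans ?_
  have := norm_mat_le x j
  gcongr

theorem continuous_mat (j : Fin m) : Continuous fun x : MatTuple m N => x.mat j :=
  (LinearMap.continuous_of_finiteDimensional (SAMat.toMatrix (N := N))).comp
    (PiLp.continuous_apply 2 _ j)

theorem continuous_eval (p : NCP m) : Continuous fun x : MatTuple m N => NCP.eval x.mat p := by
  induction p using NCP.induction_var with
  | h1 => simpa using continuous_const
  | hv j p hp => simp only [map_mul, NCP.eval_var]; exact (continuous_mat j).mul hp
  | ha p q hp hq => simp only [map_add]; exact hp.add hq
  | hs c p hp => simp only [map_smul]; exact hp.const_smul c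

/-- The law `λ_x` as a linear functional. -/
noncomputable def law (x : MatTuple m N) : NCP m →ₗ[ℂ] ℂ :=
  tauN N ∘ₗ (NCP.eval x.mat).toLinearMap

theorem law_apply (x : MatTuple m N) (p : NCP m) : x.law p = tauN N (NCP.eval x.mat p) := rfl

theorem law_mul_comm (x : MatTuple m N) (p q : NCP m) : x.law (p * q) = x.law (q * p) := by
  simp only [law_apply, map_mul (NCP.eval x.mat)]
  exact tauN_mul_comm N _ _

theorem continuous_law (p : NCP m) : Continuous fun x : MatTuple m N => x.law p :=
  (LinearMap.continuous_of_finiteDimensional (tauN N)).comp (continuous_eval p)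

theorem exists_norm_eval_le (p : NCP m) (R : ℝ) : ∃ C : ℝ, 0 ≤ C ∧ ∀ (N : ℕ) (x : MatTuple m N),
    x.opNorm ≤ R → ‖NCP.eval x.mat p‖ ≤ C := by
  induction p using NCP.induction_var with
  | h1 =>
    -- Only the inequality ‖1‖ ≤ 1 holds for all N, since the identity has norm 0 when N = 0.
    refine ⟨1, zero_le_one, fun N x _ => ?_⟩
    rw [map_one, Matrix.cstar_norm_def, map_one]
    exact ContinuousLinearMap.norm_id_le
  | hv j p hp =>
    obtain ⟨C, hC, h⟩ := hp
    refine ⟨|R| * C, by positivity, fun N x hx => ?_⟩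
    rw [map_mul, NCP.eval_var]
    exact (norm_mul_le _ _).trans (mul_le_mul (((norm_mat_le x j).trans hx).trans (le_abs_self R))
      (h N x hx) (norm_nonneg _) (abs_nonneg R))
  | ha p q hp hq =>
    obtain ⟨C, hC, h⟩ := hp
    obtain ⟨D, hD, h'⟩ := hq
    refine ⟨C + D, by positivity, fun N x hx => ?_⟩
    rw [map_add]
    exact (norm_add_le _ _).trans (add_le_add (h N x hx) (h' N x hx))
  | hs c p hp =>
    obtain ⟨C, hC, h⟩ := hp
    refine ⟨‖c‖ * C, by positivity, fun N x hx => ?_⟩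
    rw [map_smul, norm_smul]
    exact mul_le_mul_of_nonneg_left (h N x hx) (norm_nonneg _)

/-- A continuous function of the law is bounded on tuples of bounded operator norm, uniformly in
the size. -/
theorem exists_bound_of_continuous {E : Type*} [SeminormedAddCommGroup E]
    {G : (NCP m → ℂ) → E} (hG : Continuous G) (R : ℝ) :
    ∃ C : ℝ, 0 ≤ C ∧ ∀ (N : ℕ) (x : MatTuple m N), x.opNorm ≤ R → ‖G x.law‖ ≤ C := by
  choose C _ hC using fun p : NCP m => exists_norm_eval_le p R
  -- By Tychonoff the product of the discs of radii C p is compact; it contains the laws of all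
  -- tuples with ‖x‖_∞ ≤ R, whatever N is.
  have hK : IsCompact (Set.univ.pi fun p : NCP m => Metric.closedBall (0 : ℂ) (C p)) :=
    isCompact_univ_pi fun p => isCompact_closedBall _ _
  obtain ⟨B, hB⟩ := hK.exists_bound_of_continuousOn hG.continuousOn
  refine ⟨max B 0, le_max_right _ _, fun N x hx => (hB _ fun p _ => ?_).trans (le_max_left _ _)⟩
  rw [mem_closedBall_zero_iff]
  exact (norm_tauN_le _).trans (hC p N x hx)

theorem continuous_comp_law {E : Type*} [TopologicalSpace E]
    {G : (NCP m → ℂ) → E} (hG : Continuous G) : Continuous fun x : MatTuple m N => G x.law :=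
  hG.comp (continuous_pi fun p => continuous_law p)

theorem evalTrP_apply (f : Fin m → TrP1 m) (x : MatTuple m N) (j : Fin m) :
    x.evalTrP f j = NCP.eval x.mat (TrP1.reduce x.law x.law_mul_comm (f j)) :=
  TrP1.eval_eq_reduce _ _ _ _ (fun _ => rfl) _

theorem norm2_evalTrP_sq (f : Fin m → TrP1 m) (x : MatTuple m N) :
    norm2 (x.evalTrP f) ^ 2 = ∑ j, (x.law (NCP.conj (TrP1.reduce x.law x.law_mul_comm (f j)) *
      TrP1.reduce x.law x.law_mul_comm (f j))).re := by
  rw [norm2_sq]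
  refine Finset.sum_congr rfl fun j _ => ?_
  rw [evalTrP_apply, law_apply, map_mul (NCP.eval x.mat), NCP.eval_conj x.star_mat]
  rfl

theorem evalTrP_sub (f g : Fin m → TrP1 m) (x : MatTuple m N) :
    x.evalTrP (f - g) = x.evalTrP f - x.evalTrP g := by
  ext1 j
  simp [evalTrP]

theorem tauN_evalTrP_mul (f : Fin m → TrP1 m) (x : MatTuple m N) (j : Fin m) (p : NCP m) :
    tauN N (x.evalTrP f j * NCP.eval x.mat p) =
      x.law (TrP1.reduce x.law x.law_mul_comm (f j) * p) := by
  rw [evalTrP_apply, law_apply, map_mul (NCP.eval x.mat)]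

theorem evenMoment_nonneg (n : ℕ) (x : MatTuple m N) : 0 ≤ x.evenMoment n := by
  refine Finset.sum_nonneg fun j _ => ?_
  have h : x.mat j ^ (2 * n) = (x.mat j ^ n)ᴴ * x.mat j ^ n := by
    rw [Matrix.conjTranspose_pow, two_mul, pow_add]
    congr 2
    exact (x.star_mat j).symm
  rw [h, tauN_conjTranspose_mul_self, Complex.ofReal_re]
  have := hsSq_nonneg (x.mat j ^ n)
  positivity

theorem evenMoment_eq_law (n : ℕ) (x : MatTuple m N) :
    x.evenMoment n = ∑ j, (x.law (NCP.var j ^ (2 * n))).re := by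
  simp [evenMoment, law_apply, NCP.eval_var]

end MatTuple

/-! ### Integration by parts for Gibbs measures -/

section IntegrationByParts

/-- Meant for the derivative of the potential, which is measurable and locally bounded but need not
be continuous. -/
theorem integrable_of_bounded_of_compact {E : Type*} [NormedAddCommGroup E] [MeasurableSpace E]
    [BorelSpace E] {G : Type*} [NormedAddCommGroup G] {μ : Measure E} [IsFiniteMeasureOnCompacts μ] {f : E → G}
    (hf : AEStronglyMeasurable f μ) {K : Set E} (hK : IsCompact K) (h0 : ∀ x, x ∉ K → f x = 0)
    {C : ℝ} (hC : ∀ x ∈ K, ‖f x‖ ≤ C) : Integrable f μ := by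
  have hs : Function.support f ⊆ K := fun x hx => by
    by_contra h
    exact hx (h0 x h)
  rw [← integrableOn_iff_integrable_of_support_subset hs]
  refine Measure.integrableOn_of_bounded (M := C) hK.measure_lt_top.ne hf ?_
  exact (ae_restrict_iff' hK.measurableSet).2 (Eventually.of_forall hC)

theorem inner_gradient {E : Type*} [NormedAddCommGroup E] [InnerProductSpace ℝ E]
    [CompleteSpace E] (f : E → ℝ) (x v : E) : inner ℝ (gradient f x) v = fderiv ℝ f x v := by
  rw [gradient, InnerProductSpace.toDual_symm_apply]

theorem norm_gradient {E : Type*} [NormedAddCommGroup E] [InnerProductSpace ℝ E]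
    [CompleteSpace E] (f : E → ℝ) (x : E) : ‖gradient f x‖ = ‖fderiv ℝ f x‖ := by
  rw [gradient, LinearIsometryEquiv.norm_map]

variable {E : Type*} [NormedAddCommGroup E] [InnerProductSpace ℝ E] [FiniteDimensional ℝ E]
  [MeasurableSpace E] [BorelSpace E]
  {G : Type*} [NormedAddCommGroup G] [NormedSpace ℝ G]

/-- Integration by parts against a measure with density proportional to `exp u`. -/
theorem integral_fderiv_smul_tilted {u : E → ℝ} (hu : Differentiable ℝ u)
    (hb : ∀ K : Set E, IsCompact K → ∃ C : ℝ, ∀ x ∈ K, ‖fderiv ℝ u x‖ ≤ C)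
    {F : E → G} (hF : ContDiff ℝ 1 F) (hc : HasCompactSupport F) (v : E) :
    ∫ x, (fderiv ℝ u x v) • F x ∂((volume : Measure E).tilted u) =
      -∫ x, fderiv ℝ F x v ∂((volume : Measure E).tilted u) := by
  rw [integral_tilted, integral_tilted]
  -- If exp u is not integrable then Z = 0 by convention, the density exp u / Z is identically 0,
  -- and the identity reads 0 = 0; no case distinction is needed.
  set Z : ℝ := ∫ x, Real.exp (u x)
  have hd : ∀ x, HasFDerivAt (fun x => Real.exp (u x) / Z)
      ((Real.exp (u x) / Z) • fderiv ℝ u x) x := fun x => by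
    have h := ((hu x).hasFDerivAt.exp).mul_const Z⁻¹
    simp only [← div_eq_mul_inv] at h
    rw [show (Real.exp (u x) / Z) • fderiv ℝ u x = Z⁻¹ • Real.exp (u x) • fderiv ℝ u x by
      rw [smul_smul, div_eq_inv_mul]]
    exact h
  have hcont : Continuous fun x => Real.exp (u x) / Z := by
    have := hu.continuous
    fun_prop
  have hFv : Continuous fun x => fderiv ℝ F x v :=
    (hF.continuous_fderiv one_ne_zero).clm_apply continuous_const
  -- There is no boundary term because F has compact support. Only the integrability of the term
  -- with the derivative of u is delicate; `hb` provides it.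
  have key := integral_smul_fderiv_eq_neg_fderiv_smul_of_integrable (μ := (volume : Measure E))
    (f := fun x => Real.exp (u x) / Z) (g := F) (v := v) ?_ ?_ ?_
    (fun x _ => (hd x).differentiableAt) (fun x _ => (hF.differentiable one_ne_zero) x)
  · rw [key, neg_neg]
    refine integral_congr_ae (Eventually.of_forall fun x => ?_)
    simp only
    rw [(hd x).fderiv, smul_smul]
    rfl
  · simp only [fun x => (hd x).fderiv]
    obtain ⟨C, hC⟩ := hb _ hc
    obtain ⟨D, hD⟩ := hc.isCompact.exists_bound_of_continuousOn hcont.continuousOn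
    obtain ⟨B, hB⟩ := hc.isCompact.exists_bound_of_continuousOn hF.continuous.continuousOn
    refine integrable_of_bounded_of_compact (C := |D| * (|C| * ‖v‖) * |B|) ?_ hc ?_ ?_
    · refine AEStronglyMeasurable.smul ?_ hF.continuous.aestronglyMeasurable
      refine (Measurable.mul ?_ ?_).aestronglyMeasurable
      · exact hcont.measurable
      · exact measurable_fderiv_apply_const ℝ u v
    · intro x hx
      rw [image_eq_zero_of_notMem_tsupport hx, smul_zero]
    · intro x hx
      rw [norm_smul]
      refine mul_le_mul ?_ ((hB x hx).trans (le_abs_self B)) (norm_nonneg _) (by positivity)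
      change ‖(Real.exp (u x) / Z) * fderiv ℝ u x v‖ ≤ _
      rw [norm_mul]
      refine mul_le_mul ((hD x hx).trans (le_abs_self D)) ?_ (norm_nonneg _) (abs_nonneg D)
      refine ((fderiv ℝ u x).le_opNorm v).trans ?_
      exact mul_le_mul_of_nonneg_right ((hC x hx).trans (le_abs_self C)) (norm_nonneg v)
  · refine (hcont.smul hFv).integrable_of_hasCompactSupport ?_
    exact HasCompactSupport.smul_left (hc.fderiv_apply ℝ v)
  · exact (hcont.smul hF.continuous).integrable_of_hasCompactSupport hc.smul_left

theorem measurable_gradient (f : E → ℝ) : Measurable fun x => gradient f x :=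
  (InnerProductSpace.toDual ℝ E).symm.continuous.measurable.comp (measurable_fderiv ℝ f)

/-- Integration by parts for the scalar f in each direction v is the v-component of the defining
relation of the score. -/
theorem isScore_tilted {u : E → ℝ} (hu : Differentiable ℝ u)
    (hb : ∀ K : Set E, IsCompact K → ∃ C : ℝ, ∀ x ∈ K, ‖fderiv ℝ u x‖ ≤ C)
    [IsFiniteMeasure ((volume : Measure E).tilted u)]
    (hL : MemLp (fun x => -gradient u x) 2 ((volume : Measure E).tilted u)) :
    IsScore ((volume : Measure E).tilted u) fun x => -gradient u x := by
  refine ⟨hL, fun f hf hc => ?_⟩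
  have hi := hL.integrable one_le_two
  have hcg : Continuous fun x => gradient f x :=
    (InnerProductSpace.toDual ℝ E).symm.continuous.comp (hf.continuous_fderiv (by simp))
  have h1 : Integrable (fun x => f x • -gradient u x) ((volume : Measure E).tilted u) := by
    obtain ⟨C, hC⟩ := hc.exists_bound_of_continuous hf.continuous
    exact hi.bdd_smul C hf.continuous.aestronglyMeasurable (Eventually.of_forall hC)
  have h2 : Integrable (fun x => gradient f x) ((volume : Measure E).tilted u) := by
    refine hcg.integrable_of_hasCompactSupport ?_
    exact (hc.fderiv ℝ).comp_left (g := fun L => (InnerProductSpace.toDual ℝ E).symm L) (map_zero _)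
  refine ext_inner_left ℝ fun v => ?_
  rw [← integral_inner h1, ← integral_inner h2]
  have := integral_fderiv_smul_tilted hu hb (hf.of_le (by simp)) hc v
  rw [← neg_eq_iff_eq_neg, ← integral_neg] at this
  calc _ = ∫ x, -(fderiv ℝ u x v • f x) ∂((volume : Measure E).tilted u) := by
        refine integral_congr_ae (Eventually.of_forall fun x => ?_)
        simp only [inner_smul_right, inner_neg_right]
        rw [real_inner_comm, inner_gradient, smul_eq_mul]
        ring
    _ = _ := by
        rw [this]
        refine integral_congr_ae (Eventually.of_forall fun x => ?_)
        simp only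
        rw [real_inner_comm, inner_gradient]

/-- Testing against smooth compactly supported functions determines a score almost everywhere, so
the infimum runs over a single value. -/
theorem fisherInfo_eq_of_isScore {μ : Measure E} [IsFiniteMeasure μ] {Ξ : E → E}
    (h : IsScore μ Ξ) : fisherInfo μ = ∫⁻ x, ‖Ξ x‖ₑ ^ 2 ∂μ := by
  refine le_antisymm (iInf₂_le Ξ h) (le_iInf₂ fun Ξ' h' => ?_)
  have hae : Ξ =ᵐ[μ] Ξ' := by
    refine ae_eq_of_integral_contDiff_smul_eq (h.1.integrable one_le_two).locallyIntegrable
      (h'.1.integrable one_le_two).locallyIntegrable fun g hg hc => ?_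
    rw [h.2 g hg hc, h'.2 g hg hc]
  refine (lintegral_congr_ae ?_).le
  filter_upwards [hae] with x hx
  rw [hx]

end IntegrationByParts

/-! ### Smooth cut-off functions -/

/-- Mollification of the 1-Lipschitz function ψ = max 0 (min 1 (R + 2 - ‖x‖_∞)) by a bump supported
in the Euclidean unit ball. Moving by less than 1 changes ‖x‖_∞ by less than 1: the plateau ψ = 1 on
‖x‖_∞ ≤ R + 1 gives χ = 1 on ‖x‖_∞ ≤ R, and ψ = 0 on ‖x‖_∞ ≥ R + 2 gives χ = 0 beyond R + 3.
Averaging translates keeps the Lipschitz constant 1, hence a gradient bound free of N. -/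
theorem MatTuple.exists_cutoff {m N : ℕ} (R : ℝ) : ∃ χ : MatTuple m N → ℝ,
    ContDiff ℝ ∞ χ ∧ HasCompactSupport χ ∧ (∀ x, 0 ≤ χ x) ∧ (∀ x, χ x ≤ 1) ∧
    (∀ x, x.opNorm ≤ R → χ x = 1) ∧ (∀ x, R + 3 < x.opNorm → χ x = 0) ∧
    ∀ x, ‖gradient χ x‖ ≤ 1 := by
  let ψ : MatTuple m N → ℝ := fun x => max 0 (min 1 (R + 2 - x.opNorm))
  have hψ : LipschitzWith 1 ψ := by
    have h : LipschitzWith 1 fun x : MatTuple m N => R + 2 - x.opNorm := by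
      simpa using (LipschitzWith.const (R + 2)).sub MatTuple.lipschitzWith_opNorm
    exact (h.const_min 1).const_max 0
  have hψ0 : ∀ x, 0 ≤ ψ x := fun x => le_max_left _ _
  have hψ1 : ∀ x, ψ x ≤ 1 := fun x => max_le zero_le_one (min_le_left _ _)
  let φ : ContDiffBump (0 : MatTuple m N) := ⟨1 / 2, 1, by norm_num, by norm_num⟩
  let χ : MatTuple m N → ℝ := fun x => ∫ t, φ.normed volume t • ψ (x - t)
  have hχ : χ = MeasureTheory.convolution (φ.normed volume) ψ (ContinuousLinearMap.lsmul ℝ ℝ)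
      volume := rfl
  have hφi : ∀ g : MatTuple m N → ℝ, Continuous g →
      Integrable fun t => φ.normed volume t • g t := fun g hg => by
    refine (φ.continuous_normed.smul hg).integrable_of_hasCompactSupport ?_
    exact φ.hasCompactSupport_normed.smul_right
  have hφ0 : ∀ t, 0 ≤ φ.normed volume t := φ.nonneg_normed
  have hφ1 : ∫ t, φ.normed (volume : Measure (MatTuple m N)) t = 1 := φ.integral_normed
  have hψc : ∀ x, Continuous fun t => ψ (x - t) := fun x =>
    hψ.continuous.comp (continuous_const.sub continuous_id)
  have hsmooth : ContDiff ℝ ∞ χ := by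
    rw [hχ]
    exact φ.hasCompactSupport_normed.contDiff_convolution_left _ φ.contDiff_normed
      hψ.continuous.locallyIntegrable
  have hball : ∀ x y : MatTuple m N, y ∈ Metric.ball x 1 →
      x.opNorm < y.opNorm + 1 ∧ y.opNorm < x.opNorm + 1 := fun x y hy => by
    rw [Metric.mem_ball, dist_eq_norm] at hy
    have h1 := MatTuple.opNorm_le_add x y
    have h2 := MatTuple.opNorm_le_add y x
    rw [norm_sub_rev] at h1
    exact ⟨by linarith, by linarith⟩
  have hone : ∀ x, x.opNorm ≤ R → χ x = 1 := fun x hx => by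
    have hval : ∀ y, y.opNorm ≤ R + 1 → ψ y = 1 := fun y hy => by
      simp only [ψ]
      rw [min_eq_left (by linarith), max_eq_right zero_le_one]
    rw [hχ, φ.normed_convolution_eq_right, hval x (by linarith)]
    intro y hy
    rw [hval x (by linarith), hval y (by linarith [(hball x y hy).2])]
  have hzero : ∀ x, R + 3 < x.opNorm → χ x = 0 := fun x hx => by
    have hval : ∀ y, R + 2 ≤ y.opNorm → ψ y = 0 := fun y hy => by
      simp only [ψ]
      rw [max_eq_left]
      exact (min_le_right _ _).trans (by linarith)
    rw [hχ, φ.normed_convolution_eq_right, hval x (by linarith)]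
    intro y hy
    rw [hval x (by linarith), hval y (by linarith [(hball x y hy).1])]
  refine ⟨χ, hsmooth, ?_, fun x => ?_, fun x => ?_, hone, hzero, fun x => ?_⟩
  · refine HasCompactSupport.of_support_subset_isCompact
      (isCompact_closedBall (0 : MatTuple m N) (√(m * (N * (R + 3) ^ 2)))) fun x hx => ?_
    have h : x.opNorm ≤ R + 3 := by
      by_contra! h
      exact hx (hzero x h)
    rw [mem_closedBall_zero_iff]
    refine Real.le_sqrt_of_sq_le ((MatTuple.norm_sq_le_opNorm x).trans ?_)
    have := x.opNorm_nonneg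
    gcongr
  · exact integral_nonneg fun t => mul_nonneg (hφ0 t) (hψ0 _)
  · calc χ x ≤ ∫ t, φ.normed volume t := by
          refine integral_mono (hφi _ (hψc x)) φ.integrable_normed fun t => ?_
          exact mul_le_of_le_one_right (hφ0 t) (hψ1 _)
      _ = 1 := hφ1
  · rw [norm_gradient]
    have hL : LipschitzWith 1 χ := by
      refine LipschitzWith.of_le_add fun x y => ?_
      have h1 : Integrable fun t => φ.normed volume t • ψ (y - t) := hφi _ (hψc y)
      have h2 : Integrable fun t => φ.normed volume t * dist x y := φ.integrable_normed.mul_const _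
      calc χ x ≤ ∫ t, (φ.normed volume t • ψ (y - t) + φ.normed volume t * dist x y) := by
            refine integral_mono (hφi _ (hψc x)) (h1.add h2) fun t => ?_
            have h := hψ.dist_le_mul (x - t) (y - t)
            rw [dist_sub_right, NNReal.coe_one, one_mul, Real.dist_eq] at h
            have h' := (abs_le.1 h).2
            simp only [smul_eq_mul]
            rw [← mul_add]
            exact mul_le_mul_of_nonneg_left (by linarith) (hφ0 t)
        _ = χ y + dist x y := by
            rw [integral_add h1 h2, integral_mul_const, hφ1, one_mul]
    simpa using norm_fderiv_le_of_lipschitz ℝ hL (x₀ := x)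

/-! ### Orthonormal bases of the space of self-adjoint matrices -/

namespace SAMat

variable {N : ℕ} {ι : Type*} [Fintype ι]

theorem trace_mul (x y : SAMat N) :
    Matrix.trace (toMatrix x * toMatrix y) = ((inner ℝ x y : ℝ) : ℂ) := by
  rw [inner_def]
  refine (Complex.conj_eq_iff_re.1 ?_).symm
  rw [← Complex.star_def, ← Matrix.trace_conjTranspose, Matrix.conjTranspose_mul,
    toMatrix_conjTranspose, toMatrix_conjTranspose, Matrix.trace_mul_comm]

/-- A real orthonormal basis of the self-adjoint matrices is also a complex basis of all matrices,
orthonormal for the trace: split A into real and imaginary parts. -/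
theorem sum_trace_smul (e : OrthonormalBasis ι ℝ (SAMat N)) (A : Matrix (Fin N) (Fin N) ℂ) :
    ∑ i, Matrix.trace (toMatrix (e i) * A) • toMatrix (e i) = A := by
  have hs : ∀ y : SAMat N,
      ∑ i, Matrix.trace (toMatrix (e i) * toMatrix y) • toMatrix (e i) = toMatrix y := fun y => by
    conv_rhs => rw [← e.sum_repr' y, map_sum]
    refine Finset.sum_congr rfl fun i _ => ?_
    rw [trace_mul, map_smul, Complex.coe_smul]
  obtain ⟨y, z, rfl⟩ : ∃ y z : SAMat N, A = toMatrix y + Complex.I • toMatrix z :=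
    ⟨realPart A, imaginaryPart A, (realPart_add_I_smul_imaginaryPart A).symm⟩
  conv_rhs => rw [← hs y, ← hs z]
  simp only [mul_add, Matrix.trace_add, Matrix.mul_smul, Matrix.trace_smul, add_smul,
    Finset.sum_add_distrib, Finset.smul_sum, smul_assoc]

/-- Contraction over a basis separates the two sides of a product. This is the origin of τ ⊗ τ in
the conjugate variable relation. -/
theorem sum_mul_mul (e : OrthonormalBasis ι ℝ (SAMat N)) (A : Matrix (Fin N) (Fin N) ℂ) :
    ∑ i, toMatrix (e i) * A * toMatrix (e i) = Matrix.trace A • 1 := by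
  have h : ∀ a b c d, ∑ i, toMatrix (e i) a b * toMatrix (e i) c d =
      if b = c ∧ a = d then 1 else 0 := fun a b c d => by
    -- The (c, d) entry of the expansion of the matrix unit at (b, a), for which Tr(e_i · unit) is
    -- the (a, b) entry of e_i.
    have := congr_fun₂ (sum_trace_smul e (Matrix.single b a 1)) c d
    rw [Matrix.sum_apply] at this
    simpa [Matrix.single_apply, Matrix.trace_mul_single] using this
  ext a d
  rw [Matrix.sum_apply]
  simp only [Matrix.mul_apply, Finset.sum_mul]
  calc ∑ i, ∑ c, ∑ b, toMatrix (e i) a b * A b c * toMatrix (e i) c d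
      = ∑ c, ∑ b, A b c * ∑ i, toMatrix (e i) a b * toMatrix (e i) c d := by
        rw [Finset.sum_comm]
        refine Finset.sum_congr rfl fun c _ => ?_
        rw [Finset.sum_comm]
        refine Finset.sum_congr rfl fun b _ => ?_
        rw [Finset.mul_sum]
        exact Finset.sum_congr rfl fun i _ => by ring
    _ = _ := by
        simp only [h, Matrix.trace, Matrix.diag, Matrix.smul_apply, Matrix.one_apply, smul_eq_mul]
        by_cases had : a = d <;> simp [had]

end SAMat

/-! ### Derivatives of non-commutative polynomials of matrices -/

namespace MatTuple

open scoped Matrix.Norms.L2Operator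

variable {m N : ℕ}

/-- The tuple with `e` in place `j` and zeros elsewhere. -/
noncomputable def single (j : Fin m) (e : SAMat N) : MatTuple m N := WithLp.toLp 2 (Pi.single j e)

theorem inner_single (y : MatTuple m N) (j : Fin m) (e : SAMat N) :
    inner ℝ y (single j e) = inner ℝ (y j) e := by
  rw [PiLp.inner_apply, Finset.sum_eq_single j]
  · simp [single]
  · intro i _ hi
    simp [single, hi]
  · simp

/-- The map `s ⊗ t ↦ s(x) e t(x)`. -/
noncomputable def sandwich (x : MatTuple m N) (e : Matrix (Fin N) (Fin N) ℂ) :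
    NCP m ⊗[ℂ] NCP m →ₗ[ℂ] Matrix (Fin N) (Fin N) ℂ :=
  LinearMap.mul' ℂ _ ∘ₗ TensorProduct.map
    (LinearMap.mulRight ℂ e ∘ₗ (NCP.eval x.mat).toLinearMap) (NCP.eval x.mat).toLinearMap

theorem sandwich_tmul (x : MatTuple m N) (e : Matrix (Fin N) (Fin N) ℂ) (s t : NCP m) :
    sandwich x e (s ⊗ₜ t) = NCP.eval x.mat s * e * NCP.eval x.mat t := rfl

theorem sandwich_map_mulLeft (x : MatTuple m N) (e : Matrix (Fin N) (Fin N) ℂ) (i : Fin m)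
    (t : NCP m ⊗[ℂ] NCP m) :
    sandwich x e (TensorProduct.map (LinearMap.mulLeft ℂ (NCP.var i)) LinearMap.id t) =
      x.mat i * sandwich x e t := by
  induction t using TensorProduct.induction_on with
  | zero => simp
  | tmul s t => simp [sandwich_tmul, NCP.eval_var, mul_assoc]
  | add s t hs ht => simp only [map_add, hs, ht, mul_add]

/-- Each summand for s ⊗ t is Tr(e s(x) e t(x)), and `SAMat.sum_mul_mul` turns the sum into Tr s(x)
· Tr t(x). -/
theorem sum_trace_sandwich {ι : Type*} [Fintype ι] (e : OrthonormalBasis ι ℝ (SAMat N))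
    (x : MatTuple m N) (t : NCP m ⊗[ℂ] NCP m) :
    ∑ i, Matrix.trace (SAMat.toMatrix (e i) * sandwich x (SAMat.toMatrix (e i)) t) =
      (N : ℂ) ^ 2 * NCP.tensorSq x.law t := by
  induction t using TensorProduct.induction_on with
  | zero => simp
  | tmul s t =>
    have h : ∀ i, Matrix.trace (SAMat.toMatrix (e i) *
        sandwich x (SAMat.toMatrix (e i)) (s ⊗ₜ t)) =
        Matrix.trace (SAMat.toMatrix (e i) * NCP.eval x.mat s * SAMat.toMatrix (e i) *
          NCP.eval x.mat t) := fun i => by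
      rw [sandwich_tmul]; simp only [mul_assoc]
    have ht : ∀ p, (N : ℂ) * x.law p = Matrix.trace (NCP.eval x.mat p) := fun p => by
      rw [law_apply, tauN_apply]
      rcases Nat.eq_zero_or_pos N with rfl | hN
      · simp [Matrix.trace]
      · rw [mul_inv_cancel_left₀ (by exact_mod_cast hN.ne')]
    rw [Finset.sum_congr rfl fun i _ => h i, ← Matrix.trace_sum, ← Finset.sum_mul,
      SAMat.sum_mul_mul]
    simp only [NCP.tensorSq, LinearMap.comp_apply, TensorProduct.map_tmul, LinearMap.mul'_apply]
    rw [show (N : ℂ) ^ 2 * (x.law s * x.law t) = (N * x.law s) * (N * x.law t) by ring, ht, ht]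
    simp
  | add s t hs ht =>
    simp only [map_add, mul_add, Matrix.trace_add, Finset.sum_add_distrib, hs, ht]

/-- The coordinate map `x ↦ x_j` as a continuous linear map. -/
noncomputable def matCLM (j : Fin m) : MatTuple m N →L[ℝ] Matrix (Fin N) (Fin N) ℂ :=
  LinearMap.toContinuousLinearMap (SAMat.toMatrix ∘ₗ (PiLp.projₗ 2 (fun _ : Fin m => SAMat N) j :
    MatTuple m N →ₗ[ℝ] SAMat N))

theorem matCLM_apply (j : Fin m) (x : MatTuple m N) : matCLM j x = x.mat j := rfl

theorem contDiff_eval (p : NCP m) : ContDiff ℝ ∞ fun x : MatTuple m N => NCP.eval x.mat p := by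
  induction p using NCP.induction_var with
  | h1 => simpa using contDiff_const
  | hv j p hp =>
    simp only [map_mul, NCP.eval_var]
    exact (matCLM j).contDiff.mul hp
  | ha p q hp hq => simp only [map_add]; exact hp.add hq
  | hs c p hp => simp only [map_smul]; exact hp.const_smul c

/-- The directional derivative puts e in place of one occurrence of X_j at a time, which is the free
difference quotient with e written at the tensor sign. Both sides obey the recursion
`NCP.diff_var_mul`. -/
theorem fderiv_eval_single (p : NCP m) (x : MatTuple m N) (j : Fin m) (e : SAMat N) :
    fderiv ℝ (fun x : MatTuple m N => NCP.eval x.mat p) x (single j e) =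
      sandwich x (SAMat.toMatrix e) (NCP.diff j p) := by
  have hd : ∀ p : NCP m, DifferentiableAt ℝ (fun x : MatTuple m N => NCP.eval x.mat p) x :=
    fun p => (contDiff_eval p).differentiable (by simp) x
  induction p using NCP.induction_var with
  | h1 => simp [NCP.diff_one]
  | hv i p hp =>
    have h := (matCLM i).hasFDerivAt.mul' (hd p).hasFDerivAt (x := x)
    have h' : (fun x : MatTuple m N => NCP.eval x.mat (NCP.var i * p)) =
        ⇑(matCLM i) * fun x : MatTuple m N => NCP.eval x.mat p := by
      ext1 y
      simp [NCP.eval_var, matCLM_apply]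
    rw [h', h.fderiv, NCP.diff_var_mul, map_add, sandwich_map_mulLeft, ← hp, add_comm]
    change matCLM i (single j e) * NCP.eval x.mat p +
      matCLM i x * fderiv ℝ (fun x : MatTuple m N => NCP.eval x.mat p) x (single j e) = _
    rw [matCLM_apply, matCLM_apply]
    congr 1
    split_ifs with hij
    · subst hij
      simp [sandwich_tmul, mat, single]
    · simp [mat, single, hij]
  | ha p q hp hq =>
    simp only [map_add]
    rw [fderiv_fun_add (hd p) (hd q), ← hp, ← hq]
    rfl
  | hs c p hp =>
    simp only [map_smul]
    rw [fderiv_fun_const_smul (hd p), ← hp]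
    rfl

end MatTuple

/-! ### Gibbs measures on tuples of matrices -/

section Gibbs

open scoped Matrix.Norms.L2Operator

variable {m N : ℕ} {V : MatTuple m N → ℝ}

theorem isProbabilityMeasure_gibbs
    (hZ : Integrable (fun x : MatTuple m N => Real.exp (-(N : ℝ) ^ 2 * V x)) volume) :
    IsProbabilityMeasure (gibbs V) := isProbabilityMeasure_tilted hZ

theorem differentiable_potential (hV : Differentiable ℝ V) :
    Differentiable ℝ fun x => -(N : ℝ) ^ 2 * V x := hV.const_mul _

theorem gradient_potential (hV : Differentiable ℝ V) (x : MatTuple m N) :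
    gradient (fun x => -(N : ℝ) ^ 2 * V x) x = (-(N : ℝ) ^ 2) • gradient V x := by
  rw [gradient, gradient, fderiv_const_mul (hV x), map_smul]

/-- The power of N: the left side is N⁴|∇V|², while ‖DV‖₂² = N⁻¹ · N²|∇V|². -/
theorem norm_gradient_potential_sq (hV : Differentiable ℝ V) (x : MatTuple m N) :
    ‖gradient (fun x => -(N : ℝ) ^ 2 * V x) x‖ ^ 2 = (N : ℝ) ^ 3 * norm2 (normGrad V x) ^ 2 := by
  rw [gradient_potential hV, normGrad, norm2_mat_sq, norm_smul, norm_smul]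
  rcases Nat.eq_zero_or_pos N with rfl | hN
  · simp
  have hN' : (N : ℝ) ≠ 0 := by exact_mod_cast hN.ne'
  simp only [norm_neg, norm_pow, Real.norm_natCast]
  field_simp

theorem measurable_norm2_normGrad : Measurable fun x : MatTuple m N => norm2 (normGrad V x) := by
  have h : ∀ x : MatTuple m N, norm2 (normGrad V x) =
      √((N : ℝ)⁻¹ * ‖(N : ℝ) • gradient V x‖ ^ 2) := fun x => by
    rw [← norm2_mat_sq, Real.sqrt_sq (norm2_nonneg _)]; rfl
  simp only [h]
  exact ((((measurable_gradient V).const_smul (N : ℝ)).norm.pow_const 2).const_mul _).sqrt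

theorem measurable_tauN_normGrad_mul (j : Fin m) (p : NCP m) :
    Measurable fun x : MatTuple m N => tauN N (normGrad V x j * NCP.eval x.mat p) := by
  have h1 : ∀ k l, Measurable fun x : MatTuple m N => normGrad V x j k l := fun k l => by
    have h : Continuous fun y : MatTuple m N => ((N : ℝ) • y).mat j k l :=
      ((MatTuple.continuous_mat j).comp (continuous_const_smul (N : ℝ))).matrix_elem k l
    exact h.measurable.comp (measurable_gradient V)
  have h2 : ∀ k l, Measurable fun x : MatTuple m N => NCP.eval x.mat p k l := fun k l =>
    ((MatTuple.continuous_eval p).matrix_elem k l).measurable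
  simp only [tauN_apply, Matrix.trace, Matrix.diag, Matrix.mul_apply]
  exact (Finset.measurable_fun_sum _ fun k _ => Finset.measurable_fun_sum _ fun l _ =>
    (h1 k l).mul (h2 l k)).const_mul _

theorem MatTuple.continuous_evenMoment (n : ℕ) :
    Continuous fun x : MatTuple m N => x.evenMoment n := by
  simp only [MatTuple.evenMoment_eq_law]
  exact continuous_finsetSum _ fun j _ => Complex.continuous_re.comp (MatTuple.continuous_law _)

/-- The growth condition (C) replaces continuity of the derivative: the even moment is continuous,
hence bounded on compact sets. -/
theorem exists_bound_fderiv_potential (hV : Differentiable ℝ V) {a b : ℝ} {n : ℕ} (hb : 0 ≤ b)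
    (hC : ∀ x : MatTuple m N, norm2 (normGrad V x) ^ 2 ≤ a + b * x.evenMoment n)
    (K : Set (MatTuple m N)) (hK : IsCompact K) :
    ∃ C : ℝ, ∀ x ∈ K, ‖fderiv ℝ (fun x => -(N : ℝ) ^ 2 * V x) x‖ ≤ C := by
  obtain ⟨B, hB⟩ := hK.exists_bound_of_continuousOn
    (MatTuple.continuous_evenMoment (m := m) (N := N) n).continuousOn
  refine ⟨√((N : ℝ) ^ 3 * (a + b * B)), fun x hx => ?_⟩
  rw [← norm_gradient]
  refine Real.le_sqrt_of_sq_le ?_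
  rw [norm_gradient_potential_sq hV]
  have h1 := (le_abs_self _).trans (hB x hx)
  have h2 := hC x
  gcongr
  exact h2.trans (by gcongr)

/-- The integration by parts formula for `χ · p(x)` in the `j`-th coordinate. -/
theorem integral_cutoff_normGrad_mul (hN : N ≠ 0) (hV : Differentiable ℝ V)
    (hZ : Integrable (fun x : MatTuple m N => Real.exp (-(N : ℝ) ^ 2 * V x)) volume)
    {a b : ℝ} {n : ℕ} (hb : 0 ≤ b)
    (hC : ∀ x : MatTuple m N, norm2 (normGrad V x) ^ 2 ≤ a + b * x.evenMoment n)
    {χ : MatTuple m N → ℝ} (hχ : ContDiff ℝ ∞ χ) (hc : HasCompactSupport χ) (j : Fin m)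
    (p : NCP m) :
    ∫ x, χ x • tauN N (normGrad V x j * NCP.eval x.mat p) ∂gibbs V =
      ∫ x, χ x • NCP.tensorSq x.law (NCP.diff j p) ∂gibbs V +
      ((N : ℂ) ^ 2)⁻¹ * ∫ x, Matrix.trace ((gradient χ x).mat j * NCP.eval x.mat p) ∂gibbs V := by
  have hP := isProbabilityMeasure_gibbs hZ
  have hN' : (N : ℂ) ≠ 0 := by exact_mod_cast hN
  set u : MatTuple m N → ℝ := fun x => -(N : ℝ) ^ 2 * V x with hu
  have hbd := exists_bound_fderiv_potential hV hb hC
  let e := stdOrthonormalBasis ℝ (SAMat N)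
  let T : SAMat N → Matrix (Fin N) (Fin N) ℂ →L[ℝ] ℂ := fun y => LinearMap.toContinuousLinearMap
    ((Matrix.traceLinearMap (Fin N) ℂ ℂ ∘ₗ LinearMap.mulLeft ℂ (SAMat.toMatrix y)).restrictScalars
      ℝ)
  have hT : ∀ y A, T y A = Matrix.trace (SAMat.toMatrix y * A) := fun y A => rfl
  have hTx : ∀ y, ContDiff ℝ ∞ fun x : MatTuple m N => T y (NCP.eval x.mat p) := fun y =>
    (T y).contDiff.comp (MatTuple.contDiff_eval p)
  -- Each F i is differentiated in the direction of e_i in coordinate j. The sum over i is the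
  -- divergence of the matrix-valued field χ p(x) placed in that coordinate.
  let F : Fin _ → MatTuple m N → ℂ := fun i x => χ x • T (e i) (NCP.eval x.mat p)
  have hF : ∀ i, ContDiff ℝ ∞ (F i) := fun i => hχ.smul (hTx _)
  have hFc : ∀ i, HasCompactSupport (F i) := fun i => hc.smul_right
  have hibp : ∀ i, ∫ x, (fderiv ℝ u x (MatTuple.single j (e i))) • F i x ∂gibbs V =
      -∫ x, fderiv ℝ (F i) x (MatTuple.single j (e i)) ∂gibbs V := fun i =>
    integral_fderiv_smul_tilted (differentiable_potential hV) hbd ((hF i).of_le (by simp)) (hFc i) _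
  have hi1 : ∀ i, Integrable (fun x => (fderiv ℝ u x (MatTuple.single j (e i))) • F i x)
      (gibbs V) := fun i => by
    obtain ⟨C, hC'⟩ := hbd _ (hFc i)
    obtain ⟨D, hD⟩ := (hFc i).exists_bound_of_continuous (hF i).continuous
    refine integrable_of_bounded_of_compact (C := C * ‖MatTuple.single j (e i)‖ * D) ?_ (hFc i)
      (fun x hx => ?_) fun x hx => ?_
    · exact (measurable_fderiv_apply_const ℝ u _).aestronglyMeasurable.smul
        (hF i).continuous.aestronglyMeasurable
    · rw [image_eq_zero_of_notMem_tsupport hx, smul_zero]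
    · rw [norm_smul]
      have h1 := (fderiv ℝ u x).le_of_opNorm_le (hC' x hx) (MatTuple.single j (e i))
      exact mul_le_mul h1 (hD x) (norm_nonneg _) ((norm_nonneg _).trans h1)
  have hi2 : ∀ i, Integrable (fun x => fderiv ℝ (F i) x (MatTuple.single j (e i))) (gibbs V) :=
    fun i => (((hF i).continuous_fderiv (by simp)).clm_apply
      continuous_const).integrable_of_hasCompactSupport ((hFc i).fderiv_apply ℝ _)
  have hsum := Finset.sum_congr (rfl : Finset.univ = Finset.univ) fun i _ => hibp i
  rw [Finset.sum_neg_distrib, ← integral_finsetSum _ fun i _ => hi1 i,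
    ← integral_finsetSum _ fun i _ => hi2 i] at hsum
  have hexp : ∀ (y : SAMat N) (A : Matrix (Fin N) (Fin N) ℂ),
      ∑ i, (inner ℝ y (e i)) • Matrix.trace (SAMat.toMatrix (e i) * A) =
        Matrix.trace (SAMat.toMatrix y * A) := fun y A => by
    conv_rhs => rw [← e.sum_repr' y]
    simp only [map_sum, map_smul, Finset.sum_mul, smul_mul_assoc, Matrix.trace_sum,
      Matrix.trace_smul, real_inner_comm]
  -- Expanding the j-th gradient component in the basis gives -N² χ Tr((∇V)_j p), which is -N² χ
  -- τ_N((DV)_j p) because DV = N∇V and τ_N = N⁻¹Tr.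
  have hl : ∀ x, ∑ i, (fderiv ℝ u x (MatTuple.single j (e i))) • F i x =
      -((N : ℂ) ^ 2) * (χ x • tauN N (normGrad V x j * NCP.eval x.mat p)) := fun x => by
    have h1 : ∀ i, (fderiv ℝ u x (MatTuple.single j (e i))) • F i x =
        χ x • ((inner ℝ ((gradient u x) j) (e i)) •
          Matrix.trace (SAMat.toMatrix (e i) * NCP.eval x.mat p)) := fun i => by
      rw [← inner_gradient, MatTuple.inner_single, smul_comm]
      rfl
    rw [Finset.sum_congr rfl fun i _ => h1 i, ← Finset.smul_sum, hexp, gradient_potential hV]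
    simp only [normGrad, MatTuple.mat, PiLp.smul_apply, map_smul, smul_mul_assoc,
      Matrix.trace_smul, tauN_apply, Complex.real_smul]
    push_cast
    field_simp
  -- Product rule: the derivative of χ reassembles to Tr((∇χ)_j p), and the derivative of p
  -- contracts to N² (τ_N ⊗ τ_N)(𝒟_j p).
  have hr : ∀ x, ∑ i, fderiv ℝ (F i) x (MatTuple.single j (e i)) =
      Matrix.trace ((gradient χ x).mat j * NCP.eval x.mat p) +
        (N : ℂ) ^ 2 * (χ x • NCP.tensorSq x.law (NCP.diff j p)) := fun x => by
    have h1 : ∀ i, fderiv ℝ (F i) x (MatTuple.single j (e i)) =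
        (inner ℝ ((gradient χ x) j) (e i)) •
          Matrix.trace (SAMat.toMatrix (e i) * NCP.eval x.mat p) +
        χ x • Matrix.trace (SAMat.toMatrix (e i) *
          MatTuple.sandwich x (SAMat.toMatrix (e i)) (NCP.diff j p)) := fun i => by
      have hp := (MatTuple.contDiff_eval (m := m) (N := N) p).differentiable (by simp) x
      have hd := (hχ.differentiable (by simp) x).hasFDerivAt.smul
        ((T (e i)).hasFDerivAt.comp x hp.hasFDerivAt)
      have hd' : fderiv ℝ (F i) x = _ := hd.fderiv
      rw [hd', ← MatTuple.fderiv_eval_single, ← MatTuple.inner_single, inner_gradient, add_comm]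
      rfl
    rw [Finset.sum_congr rfl fun i _ => h1 i, Finset.sum_add_distrib, hexp, ← Finset.smul_sum,
      MatTuple.sum_trace_sandwich, Complex.real_smul, Complex.real_smul]
    simp only [MatTuple.mat]
    ring
  obtain ⟨G, hG, hG'⟩ := NCP.exists_continuous_tensorSq (NCP.diff j p)
  have hi3 : Integrable (fun x => χ x • NCP.tensorSq x.law (NCP.diff j p)) (gibbs V) := by
    simp only [hG']
    exact (hχ.continuous.smul (MatTuple.continuous_comp_law hG)).integrable_of_hasCompactSupport
      hc.smul_right
  have hi4 : Integrable (fun x => Matrix.trace ((gradient χ x).mat j * NCP.eval x.mat p))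
      (gibbs V) := by
    have h : Continuous fun x => gradient χ x :=
      (InnerProductSpace.toDual ℝ (MatTuple m N)).symm.continuous.comp
        (hχ.continuous_fderiv (by simp))
    refine Continuous.integrable_of_hasCompactSupport ?_ ?_
    · exact (((MatTuple.continuous_mat j).comp h).mul (MatTuple.continuous_eval p)).matrix_trace
    · refine (hc.fderiv ℝ).mono fun x hx h0 => hx ?_
      simp only
      rw [gradient, h0, map_zero]
      simp [MatTuple.mat]
  simp only [hl, hr] at hsum
  rw [integral_const_mul, integral_add hi4 (hi3.const_mul _), integral_const_mul] at hsum
  have hN2 : (N : ℂ) ^ 2 ≠ 0 := pow_ne_zero 2 hN'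
  field_simp
  linear_combination -hsum

/-- The approximate Schwinger–Dyson equation for `μ_N`. -/
theorem norm_integral_cutoff_sub_le (hN : N ≠ 0) (hV : Differentiable ℝ V)
    (hZ : Integrable (fun x : MatTuple m N => Real.exp (-(N : ℝ) ^ 2 * V x)) volume)
    {a b : ℝ} {n : ℕ} (hb : 0 ≤ b)
    (hC : ∀ x : MatTuple m N, norm2 (normGrad V x) ^ 2 ≤ a + b * x.evenMoment n)
    {χ : MatTuple m N → ℝ} (hχ : ContDiff ℝ ∞ χ) (hc : HasCompactSupport χ)
    (hg : ∀ x, ‖gradient χ x‖ ≤ 1) {R : ℝ} (hR : ∀ x, R < x.opNorm → χ x = 0)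
    (j : Fin m) (p : NCP m) {C : ℝ} (hC0 : 0 ≤ C)
    (hp : ∀ x : MatTuple m N, x.opNorm ≤ R → ‖NCP.eval x.mat p‖ ≤ C) :
    ‖∫ x, χ x • tauN N (normGrad V x j * NCP.eval x.mat p) ∂gibbs V -
      ∫ x, χ x • NCP.tensorSq x.law (NCP.diff j p) ∂gibbs V‖ ≤ C / N := by
  have hP := isProbabilityMeasure_gibbs hZ
  have hN1 : (1 : ℝ) ≤ N := by exact_mod_cast Nat.one_le_iff_ne_zero.2 hN
  rw [integral_cutoff_normGrad_mul hN hV hZ hb hC hχ hc j p, add_sub_cancel_left, norm_mul]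
  -- Where ∇χ does not vanish, Cauchy–Schwarz with |∇χ| ≤ 1 bounds the trace by √N · C. The cruder N
  -- · C suffices, since the prefactor N⁻² leaves C / N.
  have hbd : ∀ x : MatTuple m N,
      ‖Matrix.trace ((gradient χ x).mat j * NCP.eval x.mat p)‖ ≤ N * C := fun x => by
    rcases lt_or_ge R x.opNorm with hx | hx
    · have h0 : χ =ᶠ[𝓝 x] fun _ => 0 := by
        filter_upwards [MatTuple.continuous_opNorm.continuousAt.eventually_const_lt hx] with y hy
        exact hR y hy
      have h1 : gradient χ x = 0 := by
        rw [gradient, h0.fderiv_eq]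
        simp
      rw [h1]
      simpa [MatTuple.mat] using mul_nonneg (by positivity) hC0
    · refine (norm_trace_mul_le _ _).trans ?_
      have h1 : √(hsSq ((gradient χ x).mat j)) ≤ 1 := by
        refine Real.sqrt_le_one.2 ?_
        have h : hsSq ((gradient χ x).mat j) = ‖(gradient χ x) j‖ ^ 2 := by
          rw [← real_inner_self_eq_norm_sq, SAMat.inner_def, SAMat.trace_mul_self]
          rfl
        rw [h]
        exact pow_le_one₀ (norm_nonneg _) ((PiLp.norm_apply_le _ j).trans (hg x))
      have h2 : √(hsSq (NCP.eval x.mat p)) ≤ N * C := by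
        refine Real.sqrt_le_iff.2 ⟨by positivity, (hsSq_le _).trans ?_⟩
        have := hp x hx
        rw [mul_pow]
        exact mul_le_mul (le_self_pow₀ hN1 two_ne_zero) (by gcongr) (by positivity) (by positivity)
      calc _ ≤ 1 * (N * C) := mul_le_mul h1 h2 (Real.sqrt_nonneg _) zero_le_one
        _ = _ := one_mul _
  have hI := norm_integral_le_of_norm_le_const (μ := gibbs V) (Eventually.of_forall hbd)
  rw [probReal_univ, mul_one] at hI
  rw [norm_inv, norm_pow, Complex.norm_natCast]
  calc ((N : ℝ) ^ 2)⁻¹ * _ ≤ ((N : ℝ) ^ 2)⁻¹ * (N * C) := by gcongr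
    _ = C / N := by field_simp

/-- The finiteness hypothesis puts the candidate score N²∇V in L²; it is supplied for large N by
convergence of these integrals to a finite limit. -/
theorem fisherInfo_gibbs (hV : Differentiable ℝ V)
    (hZ : Integrable (fun x : MatTuple m N => Real.exp (-(N : ℝ) ^ 2 * V x)) volume)
    {a b : ℝ} {n : ℕ} (hb : 0 ≤ b) (hN : N ≠ 0)
    (hC : ∀ x : MatTuple m N, norm2 (normGrad V x) ^ 2 ≤ a + b * x.evenMoment n)
    (hfin : ∫⁻ x, ENNReal.ofReal (norm2 (normGrad V x) ^ 2) ∂gibbs V ≠ ⊤) :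
    ((N : ℝ≥0∞) ^ 3)⁻¹ * fisherInfo (gibbs V) =
      ∫⁻ x, ENNReal.ofReal (norm2 (normGrad V x) ^ 2) ∂gibbs V := by
  have hP := isProbabilityMeasure_gibbs hZ
  have hsq : ∀ x, ‖-gradient (fun x => -(N : ℝ) ^ 2 * V x) x‖ₑ ^ 2 =
      (N : ℝ≥0∞) ^ 3 * ENNReal.ofReal (norm2 (normGrad V x) ^ 2) := fun x => by
    rw [enorm_neg, ← ofReal_norm, ← ENNReal.ofReal_pow (norm_nonneg _),
      norm_gradient_potential_sq hV, ENNReal.ofReal_mul (by positivity),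
      ENNReal.ofReal_pow (by positivity), ENNReal.ofReal_natCast]
  have hN3 : (N : ℝ≥0∞) ^ 3 ≠ ⊤ := by finiteness
  have hint : ∫⁻ x, ‖-gradient (fun x => -(N : ℝ) ^ 2 * V x) x‖ₑ ^ 2 ∂gibbs V =
      (N : ℝ≥0∞) ^ 3 * ∫⁻ x, ENNReal.ofReal (norm2 (normGrad V x) ^ 2) ∂gibbs V := by
    simp only [hsq]
    rw [lintegral_const_mul' _ _ hN3]
  have hL : MemLp (fun x => -gradient (fun x => -(N : ℝ) ^ 2 * V x) x) 2 (gibbs V) := by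
    refine ⟨(measurable_gradient _).neg.aestronglyMeasurable, ?_⟩
    rw [eLpNorm_lt_top_iff_lintegral_rpow_enorm_lt_top two_ne_zero ENNReal.ofNat_ne_top]
    simp only [ENNReal.toReal_ofNat, ENNReal.rpow_ofNat]
    rw [hint]
    exact ENNReal.mul_lt_top hN3.lt_top hfin.lt_top
  have hP' : IsFiniteMeasure ((volume : Measure (MatTuple m N)).tilted
      fun x => -(N : ℝ) ^ 2 * V x) := inferInstanceAs (IsFiniteMeasure (gibbs V))
  have hS : IsScore (gibbs V) _ := isScore_tilted (differentiable_potential hV)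
    (exists_bound_fderiv_potential hV hb hC) hL
  rw [fisherInfo_eq_of_isScore hS, hint, ← mul_assoc, ENNReal.inv_mul_cancel _ hN3, one_mul]
  exact pow_ne_zero 3 (by exact_mod_cast hN)

end Gibbs

/-! ### Consequences of concentration -/

section Concentration

variable {m : ℕ} {μ : ∀ N, Measure (MatTuple m N)} [hμ : ∀ N, IsProbabilityMeasure (μ N)]
  {lam : NCLaw m} {R₀ : ℝ}

theorem tendsto_measure_close (hA : ConcentratesAround μ lam) {E : Type*}
    [PseudoMetricSpace E] {G : (NCP m → ℂ) → E} (hG : Continuous G) {ε : ℝ} (hε : 0 < ε) :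
    Tendsto (fun N => μ N {x | dist (G x.law) (G lam.toFun) < ε}) atTop (𝓝 1) := by
  let U : Set (NCLaw m) := {ν | dist (G ν.toFun) (G lam.toFun) < ε}
  have hc : Continuous fun ν : NCLaw m => G ν.toFun := hG.comp continuous_induced_dom
  have hU : U ∈ 𝓝 lam :=
    (isOpen_lt (hc.dist continuous_const) continuous_const).mem_nhds (by simpa [U] using hε)
  refine tendsto_of_tendsto_of_tendsto_of_le_of_le (hA U hU) tendsto_const_nhds
    (fun N => measure_mono ?_) fun N => prob_le_one
  rintro x ⟨ν, hν, h⟩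
  have : ν.toFun = x.law := LinearMap.ext h
  simpa [U, this] using hν

theorem tendsto_measure_far (hA : ConcentratesAround μ lam)
    (hR : Tendsto (fun N => μ N {x | R₀ ≤ x.opNorm}) atTop (𝓝 0)) {E : Type*}
    [PseudoMetricSpace E] {G : (NCP m → ℂ) → E} (hG : Continuous G) {ε : ℝ} (hε : 0 < ε) :
    Tendsto (fun N => μ N ({x | ε ≤ dist (G x.law) (G lam.toFun)} ∪ {x | R₀ ≤ x.opNorm}))
      atTop (𝓝 0) := by
  have h1 : Tendsto (fun N => μ N {x | ε ≤ dist (G x.law) (G lam.toFun)}) atTop (𝓝 0) := by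
    have h := ENNReal.Tendsto.sub (tendsto_const_nhds (x := (1 : ℝ≥0∞)))
      (tendsto_measure_close hA hG hε) (Or.inl ENNReal.one_ne_top)
    rw [tsub_self] at h
    refine h.congr fun N => ?_
    have hm : MeasurableSet {x : MatTuple m N | dist (G x.law) (G lam.toFun) < ε} :=
      (isOpen_lt ((MatTuple.continuous_comp_law hG).dist continuous_const)
        continuous_const).measurableSet
    rw [← prob_compl_eq_one_sub hm]
    congr 1
    ext x
    simp
  have h2 := h1.add hR
  rw [add_zero] at h2
  exact tendsto_of_tendsto_of_tendsto_of_le_of_le tendsto_const_nhds h2 (fun _ => zero_le)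
    fun N => measure_union_le _ _

/-- The two exceptional events together have probability less than 1 for large N. One matrix tuple
can then be picked, and deterministic matrix inequalities pass to λ. -/
theorem eventually_exists_close (hA : ConcentratesAround μ lam)
    (hR : Tendsto (fun N => μ N {x | R₀ ≤ x.opNorm}) atTop (𝓝 0)) {E : Type*}
    [PseudoMetricSpace E] {G : (NCP m → ℂ) → E} (hG : Continuous G) {ε : ℝ} (hε : 0 < ε) :
    ∀ᶠ N in atTop, ∃ x : MatTuple m N, x.opNorm < R₀ ∧ dist (G x.law) (G lam.toFun) < ε := by
  filter_upwards [(tendsto_measure_far hA hR hG hε).eventually_lt_const zero_lt_one] with N hN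
  by_contra! h
  have hu : {x : MatTuple m N | ε ≤ dist (G x.law) (G lam.toFun)} ∪ {x | R₀ ≤ x.opNorm} =
      Set.univ := Set.eq_univ_of_forall fun x => by
    rcases lt_or_ge x.opNorm R₀ with hx | hx
    · exact Or.inl (h x hx)
    · exact Or.inr hx
  rw [hu, measure_univ] at hN
  exact hN.false

/-- Closed conditions that hold for the laws of all tuples of norm less than `R₀` hold for the
limit law. -/
theorem mem_of_forall_law_mem (hA : ConcentratesAround μ lam)
    (hR : Tendsto (fun N => μ N {x | R₀ ≤ x.opNorm}) atTop (𝓝 0)) {E : Type*}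
    [PseudoMetricSpace E] {G : (NCP m → ℂ) → E} (hG : Continuous G) {S : Set E} (hS : IsClosed S)
    (h : ∀ N (x : MatTuple m N), x.opNorm < R₀ → G x.law ∈ S) : G lam.toFun ∈ S := by
  rw [← hS.closure_eq, Metric.mem_closure_iff]
  intro ε hε
  obtain ⟨N, x, hx, hd⟩ := (eventually_exists_close hA hR hG hε).exists
  exact ⟨_, h N x hx, by rwa [dist_comm]⟩

/-- Convergence of expectations of continuous functions of the law, cut off at bounded tuples. -/
theorem tendsto_integral_cutoff (hA : ConcentratesAround μ lam)
    (hR : Tendsto (fun N => μ N {x | R₀ ≤ x.opNorm}) atTop (𝓝 0)) {E : Type*}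
    [NormedAddCommGroup E] [NormedSpace ℝ E] [CompleteSpace E] {G : (NCP m → ℂ) → E}
    (hG : Continuous G) {w : ∀ N, MatTuple m N → ℝ} (hw : ∀ N, Measurable (w N))
    (hw0 : ∀ N x, 0 ≤ w N x) (hw1 : ∀ N x, w N x ≤ 1) (hw2 : ∀ N x, x.opNorm < R₀ → w N x = 1)
    {R : ℝ} (hw3 : ∀ N x, R < x.opNorm → w N x = 0) :
    (∀ N, Integrable (fun x => w N x • G x.law) (μ N)) ∧
    Tendsto (fun N => ∫ x, w N x • G x.law ∂μ N) atTop (𝓝 (G lam.toFun)) := by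
  -- The weight w is left general between R₀ and R so that both the smooth cut-off (R = R₀ + 3) and
  -- the indicator of the ball (R = R₀) qualify.
  obtain ⟨C, hC0, hC⟩ := MatTuple.exists_bound_of_continuous hG R
  set c := G lam.toFun with hc
  have hbd : ∀ N x, ‖w N x • G x.law‖ ≤ C := fun N x => by
    rcases lt_or_ge R x.opNorm with hx | hx
    · rw [hw3 N x hx, zero_smul, norm_zero]; exact hC0
    · rw [norm_smul, Real.norm_eq_abs, abs_of_nonneg (hw0 N x)]
      calc w N x * ‖G x.law‖ ≤ 1 * C :=
            mul_le_mul (hw1 N x) (hC N x hx) (norm_nonneg _) zero_le_one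
        _ = C := one_mul C
  have hint : ∀ N, Integrable (fun x => w N x • G x.law) (μ N) := fun N =>
    Integrable.of_bound ((hw N).aestronglyMeasurable.smul
      (MatTuple.continuous_comp_law hG).aestronglyMeasurable) C (Eventually.of_forall (hbd N))
  refine ⟨hint, Metric.tendsto_atTop'.2 fun ε hε => ?_⟩
  -- Off B the integrand is within ε / 2 of the limit; on B the uniform bound C + ‖c‖ is enough
  -- because the measure of B tends to 0.
  let B : ∀ N, Set (MatTuple m N) := fun N =>
    {x | ε / 2 ≤ dist (G x.law) c} ∪ {x | R₀ ≤ x.opNorm}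
  have hB : Tendsto (fun N => μ N (B N)) atTop (𝓝 0) :=
    tendsto_measure_far hA hR hG (half_pos hε)
  have hB' : Tendsto (fun N => ε / 2 + (C + ‖c‖) * (μ N).real (B N)) atTop (𝓝 (ε / 2)) := by
    have h := (ENNReal.tendsto_toReal ENNReal.zero_ne_top).comp hB
    simpa [Measure.real] using (h.const_mul (C + ‖c‖)).const_add (ε / 2)
  have hBm : ∀ N, MeasurableSet (B N) := fun N =>
    (isClosed_le continuous_const ((MatTuple.continuous_comp_law hG).dist
      continuous_const)).measurableSet.union
      (isClosed_le continuous_const MatTuple.continuous_opNorm).measurableSet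
  obtain ⟨N₀, hN₀⟩ := eventually_atTop.1 (hB'.eventually_lt_const (half_lt_self hε))
  refine ⟨N₀, fun N hN => lt_of_le_of_lt ?_ (hN₀ N hN.le)⟩
  have hpt : ∀ x, ‖w N x • G x.law - c‖ ≤
      ε / 2 + (B N).indicator (fun _ => C + ‖c‖) x := fun x => by
    by_cases hx : x ∈ B N
    · rw [Set.indicator_of_mem hx]
      have := (norm_sub_le _ _).trans (add_le_add_left (hbd N x) ‖c‖)
      linarith
    · rw [Set.indicator_of_notMem hx, add_zero]
      simp only [B, Set.mem_union, Set.mem_ofPred_eq, not_or, not_le] at hx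
      rw [hw2 N x hx.2, one_smul, ← dist_eq_norm]
      exact hx.1.le
  have hi1 : Integrable (fun x => (B N).indicator (fun _ => C + ‖c‖) x) (μ N) :=
    (integrable_const _).indicator (hBm N)
  rw [dist_eq_norm]
  calc ‖∫ x, w N x • G x.law ∂μ N - c‖ = ‖∫ x, (w N x • G x.law - c) ∂μ N‖ := by
        rw [integral_sub (hint N) (integrable_const c)]
        simp
    _ ≤ ∫ x, ‖w N x • G x.law - c‖ ∂μ N := norm_integral_le_integral_norm _
    _ ≤ ∫ x, (ε / 2 + (B N).indicator (fun _ => C + ‖c‖) x) ∂μ N :=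
        integral_mono ((hint N).sub (integrable_const c)).norm
          ((integrable_const _).add hi1) hpt
    _ = _ := by
        rw [integral_add (integrable_const _) hi1, integral_indicator (hBm N)]
        simp [mul_comm]

end Concentration

/-! ### Approximation by trace polynomials -/

section Approximation

variable {m : ℕ} {φ : ∀ N, MatTuple m N → Fin m → Matrix (Fin N) (Fin N) ℂ} {f g : Fin m → TrP1 m}
  {R₀ α β : ℝ}

theorem eventually_norm2_sub_lt (h : approxError φ f R₀ < ENNReal.ofReal α) :
    ∀ᶠ N in atTop, ∀ x : MatTuple m N, x.opNorm ≤ R₀ → norm2 (φ N x - x.evalTrP f) < α := by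
  filter_upwards [eventually_lt_of_limsup_lt h] with N hN x hx
  have h1 : ENNReal.ofReal (norm2 (φ N x - x.evalTrP f)) < ENNReal.ofReal α :=
    lt_of_le_of_lt (le_iSup₂ (f := fun (x : MatTuple m N) (_ : x.opNorm ≤ R₀) =>
      ENNReal.ofReal (norm2 (φ N x - x.evalTrP f))) x hx) hN
  exact (ENNReal.ofReal_lt_ofReal_iff_of_nonneg (norm2_nonneg _)).1 h1

/-- The square of the 2-norm of a tuple of trace polynomials with respect to a law. -/
noncomputable def NCLaw.normSq (lam : NCLaw m) (f : Fin m → TrP1 m) : ℝ :=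
  ∑ j, (lam.toFun (NCP.conj (TrP1.reduce lam.toFun lam.tracial (f j)) *
    TrP1.reduce lam.toFun lam.tracial (f j))).re

theorem exists_continuous_normSq (f : Fin m → TrP1 m) : ∃ G : (NCP m → ℂ) → ℝ, Continuous G ∧
    (∀ lam : NCLaw m, lam.normSq f = G lam.toFun) ∧
    ∀ N (x : MatTuple m N), norm2 (x.evalTrP f) ^ 2 = G x.law := by
  obtain ⟨G, hG, h⟩ := TrP1.exists_continuous_normSq f
  exact ⟨G, hG, fun lam => h _ lam.tracial, fun N x => by
    rw [MatTuple.norm2_evalTrP_sq, h _ x.law_mul_comm]⟩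

/-- At one tuple with ‖x‖_∞ < R₀ and law near λ, both f and g are close to the common reference
φ_N(x), and ‖f - g‖₂² depends continuously on the law. This is the Cauchy estimate for approximating
sequences. -/
theorem normSq_sub_le {μ : ∀ N, Measure (MatTuple m N)} [∀ N, IsProbabilityMeasure (μ N)]
    {lam : NCLaw m} (hA : ConcentratesAround μ lam)
    (hR : Tendsto (fun N => μ N {x | R₀ ≤ x.opNorm}) atTop (𝓝 0))
    (hf : approxError φ f R₀ < ENNReal.ofReal α) (hg : approxError φ g R₀ < ENNReal.ofReal β) :
    lam.normSq (f - g) ≤ (α + β) ^ 2 := by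
  obtain ⟨G, hG, h1, h2⟩ := exists_continuous_normSq (f - g)
  rw [h1]
  refine le_of_forall_pos_le_add fun ε hε => ?_
  obtain ⟨N, ⟨x, hx, hd⟩, hfN, hgN⟩ := ((eventually_exists_close hA hR hG hε).and
    ((eventually_norm2_sub_lt hf).and (eventually_norm2_sub_lt hg))).exists
  rw [← h2, Real.dist_eq] at hd
  have h3 : norm2 (x.evalTrP (f - g)) ≤ α + β := by
    rw [MatTuple.evalTrP_sub]
    refine (norm2_sub_le _ _ (φ N x)).trans ?_
    exact add_le_add (hfN x hx.le).le (hgN x hx.le).le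
  have h4 := pow_le_pow_left₀ (norm2_nonneg _) h3 2
  linarith [(abs_lt.1 hd).1]

end Approximation

/-! ### Limits of expectations for Gibbs measures -/

section GibbsLimits

open scoped Matrix.Norms.L2Operator

variable {m : ℕ} {V : ∀ N : ℕ, MatTuple m N → ℝ} {n : ℕ} {a b R₀ : ℝ}

theorem tendsto_gibbs_norm_ge
    (hD : Tendsto (fun N => ∫⁻ x in {x : MatTuple m N | R₀ ≤ x.opNorm},
      ENNReal.ofReal (1 + x.evenMoment n) ∂(gibbs (V N))) atTop (𝓝 0)) :
    Tendsto (fun N => gibbs (V N) {x | R₀ ≤ x.opNorm}) atTop (𝓝 0) := by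
  refine tendsto_of_tendsto_of_tendsto_of_le_of_le tendsto_const_nhds hD (fun _ => zero_le)
    fun N => ?_
  rw [← setLIntegral_one]
  refine lintegral_mono fun x => ?_
  rw [← ENNReal.ofReal_one]
  exact ENNReal.ofReal_le_ofReal (by linarith [x.evenMoment_nonneg n])

theorem exists_bound_norm2_normGrad (hb : 0 ≤ b)
    (hC : ∀ N (x : MatTuple m N), norm2 (normGrad (V N) x) ^ 2 ≤ a + b * x.evenMoment n) (R : ℝ) :
    ∃ K : ℝ, 0 ≤ K ∧ ∀ N (x : MatTuple m N), x.opNorm ≤ R → norm2 (normGrad (V N) x) ≤ K := by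
  have hG : Continuous fun φ : NCP m → ℂ => ∑ j, (φ (NCP.var j ^ (2 * n))).re :=
    continuous_finsetSum _ fun j _ => Complex.continuous_re.comp (continuous_apply _)
  obtain ⟨B, hB0, hB⟩ := MatTuple.exists_bound_of_continuous hG R
  refine ⟨√(a + b * B), Real.sqrt_nonneg _, fun N x hx => Real.le_sqrt_of_sq_le ?_⟩
  refine (hC N x).trans ?_
  have := (le_abs_self _).trans (hB N x hx)
  rw [MatTuple.evenMoment_eq_law]
  gcongr

theorem exists_indicator_weight (R₀ : ℝ) : ∃ w : ∀ N, MatTuple m N → ℝ,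
    (∀ N, w N = {x : MatTuple m N | x.opNorm < R₀}.indicator 1) ∧ (∀ N, Measurable (w N)) ∧
    (∀ N x, 0 ≤ w N x) ∧ (∀ N x, w N x ≤ 1) ∧ (∀ N x, x.opNorm < R₀ → w N x = 1) ∧
    ∀ N x, R₀ < x.opNorm → w N x = 0 := by
  refine ⟨fun N => {x : MatTuple m N | x.opNorm < R₀}.indicator 1, fun N => rfl, fun N => ?_, fun N x => ?_,
    fun N x => ?_, fun N x hx => ?_, fun N x hx => ?_⟩
  · exact measurable_one.indicator
      (isOpen_lt MatTuple.continuous_opNorm continuous_const).measurableSet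
  · exact Set.indicator_nonneg (fun _ _ => zero_le_one) x
  · exact Set.indicator_le_self' (fun _ _ => zero_le_one) x
  · exact Set.indicator_of_mem (s := {x : MatTuple m N | x.opNorm < R₀}) hx 1
  · exact Set.indicator_of_notMem (by simpa using hx.le) _

/-- Inside the ball of radius R₀, ‖DV_N‖₂² may be replaced by ‖f k‖₂², whose truncated expectation
tends to its value at λ. Outside, (C) bounds the integrand by the quantity that (D) makes
negligible. -/
theorem tendsto_lintegral_norm2_sq (hb : 0 < b) (ha : 0 < a)
    (hZ : ∀ N, Integrable (fun x : MatTuple m N => Real.exp (-(N : ℝ) ^ 2 * V N x)) volume)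
    {lam : NCLaw m} (hA : ConcentratesAround (fun N => gibbs (V N)) lam)
    (hC : ∀ N (x : MatTuple m N), norm2 (normGrad (V N) x) ^ 2 ≤ a + b * x.evenMoment n)
    (hD : Tendsto (fun N => ∫⁻ x in {x : MatTuple m N | R₀ ≤ x.opNorm},
      ENNReal.ofReal (1 + x.evenMoment n) ∂(gibbs (V N))) atTop (𝓝 0))
    {f : ℕ → Fin m → TrP1 m}
    (hf : Tendsto (fun k => approxError (fun N => normGrad (V N)) (f k) R₀) atTop (𝓝 0))
    {Φ : ℝ} (hΦ : Tendsto (fun k => lam.normSq (f k)) atTop (𝓝 Φ)) :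
    Tendsto (fun N => ∫⁻ x, ENNReal.ofReal (norm2 (normGrad (V N) x) ^ 2) ∂gibbs (V N)) atTop
      (𝓝 (ENNReal.ofReal Φ)) := by
  have hP := fun N => isProbabilityMeasure_gibbs (hZ N)
  have hR := tendsto_gibbs_norm_ge hD
  obtain ⟨K, hK0, hK⟩ := exists_bound_norm2_normGrad hb.le hC R₀
  obtain ⟨w, hw, hwm, hw0, hw1, hw2, hw3⟩ := exists_indicator_weight (m := m) R₀
  have hgood : ∀ N, MeasurableSet {x : MatTuple m N | x.opNorm < R₀} := fun N =>
    (isOpen_lt MatTuple.continuous_opNorm continuous_const).measurableSet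
  have hwx : ∀ N x, w N x ≠ 0 → x.opNorm < R₀ := fun N x h => by
    by_contra h'
    exact h (by rw [hw, Set.indicator_of_notMem (by exact h')])
  have hint : ∀ N, Integrable (fun x => w N x * norm2 (normGrad (V N) x) ^ 2) (gibbs (V N)) :=
    fun N => by
      refine Integrable.of_bound ((hwm N).mul
        (measurable_norm2_normGrad.pow_const 2)).aestronglyMeasurable (K ^ 2)
        (Eventually.of_forall fun x => ?_)
      rw [Real.norm_eq_abs, abs_of_nonneg (mul_nonneg (hw0 N x) (sq_nonneg _))]
      by_cases h : w N x = 0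
      · rw [h, zero_mul]; positivity
      · have h1 := hK N x (hwx N x h).le
        have h2 := norm2_nonneg (normGrad (V N) x)
        calc w N x * norm2 (normGrad (V N) x) ^ 2 ≤ 1 * K ^ 2 :=
              mul_le_mul (hw1 N x) (pow_le_pow_left₀ h2 h1 2) (sq_nonneg _) zero_le_one
          _ = _ := one_mul _
  have hreal : Tendsto (fun N => ∫ x, w N x * norm2 (normGrad (V N) x) ^ 2 ∂gibbs (V N)) atTop
      (𝓝 Φ) := by
    rw [Metric.tendsto_nhds]
    intro η hη
    -- With s = ‖DV_N‖₂ ≤ K and |s - t| ≤ α one has |s² - t²| = |s - t|(s + t) ≤ α(2K + α). The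
    -- other two thirds of η cover the limit in N and the distance of ‖f k‖₂² from Φ.
    obtain ⟨α, hα, hα'⟩ : ∃ α : ℝ, 0 < α ∧ α * (2 * K + α) < η / 3 := by
      have : Tendsto (fun α : ℝ => α * (2 * K + α)) (𝓝[>] 0) (𝓝 (0 * (2 * K + 0))) :=
        (Continuous.tendsto (by fun_prop) 0).mono_left nhdsWithin_le_nhds
      rw [zero_mul] at this
      obtain ⟨α, h1, h2⟩ := ((this.eventually_lt_const (show 0 < η / 3 by positivity)).and
        self_mem_nhdsWithin).exists
      exact ⟨α, h2, h1⟩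
    obtain ⟨k, hk1, hk2⟩ := ((hf.eventually_lt_const (ENNReal.ofReal_pos.2 hα)).and
      (Metric.tendsto_nhds.1 hΦ (η / 3) (by positivity))).exists
    obtain ⟨G, hG, hG1, hG2⟩ := exists_continuous_normSq (f k)
    obtain ⟨hGi, hGt⟩ := tendsto_integral_cutoff hA hR hG hwm hw0 hw1 hw2 hw3
    rw [hG1] at hk2
    filter_upwards [Metric.tendsto_nhds.1 hGt (η / 3) (by positivity),
      eventually_norm2_sub_lt hk1] with N hN1 hN2
    have hdiff : |∫ x, w N x * norm2 (normGrad (V N) x) ^ 2 ∂gibbs (V N) -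
        ∫ x, w N x • G x.law ∂gibbs (V N)| ≤ α * (2 * K + α) := by
      rw [← integral_sub (hint N) (hGi N)]
      have hpt : ∀ x : MatTuple m N,
          ‖w N x * norm2 (normGrad (V N) x) ^ 2 - w N x • G x.law‖ ≤ α * (2 * K + α) := fun x => by
        rw [smul_eq_mul, ← mul_sub, norm_mul, Real.norm_eq_abs, abs_of_nonneg (hw0 N x),
          Real.norm_eq_abs, ← hG2]
        by_cases h : w N x = 0
        · rw [h, zero_mul]; positivity
        have hx := (hwx N x h).le
        set s := norm2 (normGrad (V N) x)
        set t := norm2 (x.evalTrP (f k))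
        have h1 : |s - t| ≤ α := (abs_norm2_sub_norm2_le _ _).trans (hN2 x hx).le
        have h2 : s ≤ K := hK N x hx
        have hs : 0 ≤ s := norm2_nonneg _
        have ht : 0 ≤ t := norm2_nonneg _
        have h3 : |s ^ 2 - t ^ 2| ≤ α * (2 * K + α) := by
          rw [sq_sub_sq, abs_mul, mul_comm, abs_of_nonneg (by positivity : 0 ≤ s + t)]
          refine mul_le_mul h1 ?_ (by positivity) hα.le
          linarith [(abs_le.1 h1).1]
        calc w N x * |s ^ 2 - t ^ 2| ≤ 1 * (α * (2 * K + α)) :=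
              mul_le_mul (hw1 N x) h3 (abs_nonneg _) zero_le_one
          _ = _ := one_mul _
      have := norm_integral_le_of_norm_le_const (μ := gibbs (V N)) (Eventually.of_forall hpt)
      rwa [probReal_univ, mul_one, Real.norm_eq_abs] at this
    rw [Real.dist_eq] at *
    rw [abs_lt] at *
    rw [abs_le] at hdiff
    constructor <;> linarith [hdiff.1, hdiff.2, hN1.1, hN1.2, hk2.1, hk2.2]
  have hsplit : ∀ N, ∫⁻ x, ENNReal.ofReal (norm2 (normGrad (V N) x) ^ 2) ∂gibbs (V N) =
      ENNReal.ofReal (∫ x, w N x * norm2 (normGrad (V N) x) ^ 2 ∂gibbs (V N)) +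
      ∫⁻ x in {x : MatTuple m N | R₀ ≤ x.opNorm},
        ENNReal.ofReal (norm2 (normGrad (V N) x) ^ 2) ∂gibbs (V N) := fun N => by
    rw [← lintegral_add_compl _ (hgood N)]
    congr 1
    · rw [ofReal_integral_eq_lintegral_ofReal (hint N)
        (Eventually.of_forall fun x => mul_nonneg (hw0 N x) (sq_nonneg _)),
        ← lintegral_indicator (hgood N)]
      refine lintegral_congr fun x => ?_
      by_cases hx : x ∈ {x : MatTuple m N | x.opNorm < R₀}
      · rw [Set.indicator_of_mem hx, hw2 N x hx, one_mul]
      · rw [Set.indicator_of_notMem hx, hw, Set.indicator_of_notMem hx, zero_mul,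
          ENNReal.ofReal_zero]
    · congr 2
      ext x
      simp
  have hbad : Tendsto (fun N => ∫⁻ x in {x : MatTuple m N | R₀ ≤ x.opNorm},
      ENNReal.ofReal (norm2 (normGrad (V N) x) ^ 2) ∂gibbs (V N)) atTop (𝓝 0) := by
    -- The constant comes from a + b·M ≤ (a + b)(1 + M) for the even moment M ≥ 0.
    have h := ENNReal.Tendsto.const_mul (a := ENNReal.ofReal (a + b)) hD
      (Or.inr ENNReal.ofReal_ne_top)
    rw [mul_zero] at h
    refine tendsto_of_tendsto_of_tendsto_of_le_of_le tendsto_const_nhds h (fun _ => zero_le)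
      fun N => ?_
    simp only
    rw [← lintegral_const_mul' _ _ ENNReal.ofReal_ne_top]
    refine lintegral_mono fun x => ?_
    rw [← ENNReal.ofReal_mul (by positivity)]
    refine ENNReal.ofReal_le_ofReal ((hC N x).trans ?_)
    have := x.evenMoment_nonneg n
    nlinarith
  simp only [hsplit]
  simpa using (ENNReal.tendsto_ofReal hreal).add hbad

/-- The limit of the Schwinger–Dyson equation, up to the error of approximation of `DV_N`. -/
theorem norm_pairing_sub_tensorSq_le (hb : 0 < b) (ha : 0 < a) (hV : ∀ N, Differentiable ℝ (V N))
    (hZ : ∀ N, Integrable (fun x : MatTuple m N => Real.exp (-(N : ℝ) ^ 2 * V N x)) volume)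
    {lam : NCLaw m} (hA : ConcentratesAround (fun N => gibbs (V N)) lam)
    (hC : ∀ N (x : MatTuple m N), norm2 (normGrad (V N) x) ^ 2 ≤ a + b * x.evenMoment n)
    (hD : Tendsto (fun N => ∫⁻ x in {x : MatTuple m N | R₀ ≤ x.opNorm},
      ENNReal.ofReal (1 + x.evenMoment n) ∂(gibbs (V N))) atTop (𝓝 0))
    (j : Fin m) (p : NCP m) : ∃ C : ℝ, 0 ≤ C ∧ ∀ (f : Fin m → TrP1 m) (α : ℝ), 0 < α →
      approxError (fun N => normGrad (V N)) f R₀ < ENNReal.ofReal α →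
      ‖lam.toFun (TrP1.reduce lam.toFun lam.tracial (f j) * p) -
        NCP.tensorSq lam.toFun (NCP.diff j p)‖ ≤ C * α := by
  have hP := fun N => isProbabilityMeasure_gibbs (hZ N)
  have hR := tendsto_gibbs_norm_ge hD
  -- C bounds p(x) on the whole support of the cut-off, whence the radius R₀ + 3; it is fixed before
  -- f and α.
  obtain ⟨C, hC0, hCp⟩ := MatTuple.exists_norm_eval_le p (R₀ + 3)
  refine ⟨C, hC0, fun f α hα hf => ?_⟩
  choose χ hχs hχc hχ0 hχ1 hχ2 hχ3 hχ4 using fun N => MatTuple.exists_cutoff (m := m) (N := N) R₀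
  -- Two weights are needed: the smooth χ for integration by parts with DV_N, and the indicator w
  -- for the pairing with f, which is controlled only up to R₀. They agree on ‖x‖_∞ < R₀.
  obtain ⟨w, hw, hwm, hw0, hw1, hw2, hw3⟩ := exists_indicator_weight (m := m) R₀
  obtain ⟨K, hK0, hK⟩ := exists_bound_norm2_normGrad hb.le hC (R₀ + 3)
  obtain ⟨G, hG, hGt⟩ := NCP.exists_continuous_tensorSq (NCP.diff j p)
  obtain ⟨P, hPc, hPt⟩ := TrP1.exists_continuous_pairing (f j) p
  have hY := (tendsto_integral_cutoff hA hR hG (fun N => (hχs N).continuous.measurable) hχ0 hχ1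
    (fun N x hx => hχ2 N x hx.le) hχ3).2
  obtain ⟨hZi, hZl⟩ := tendsto_integral_cutoff hA hR hPc hwm hw0 hw1 hw2 hw3
  have hpt : ∀ N (x : MatTuple m N), x.opNorm ≤ R₀ + 3 →
      ‖tauN N (normGrad (V N) x j * NCP.eval x.mat p)‖ ≤ norm2 (normGrad (V N) x) * C :=
    fun N x hx => (norm_tauN_mul_le _ _).trans
      (mul_le_mul (sqrt_tauN_le_norm2 _ j) (hCp N x hx) (norm_nonneg _) (norm2_nonneg _))
  have hXb : ∀ N (x : MatTuple m N),
      ‖χ N x • tauN N (normGrad (V N) x j * NCP.eval x.mat p)‖ ≤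
        norm2 (normGrad (V N) x) * C := fun N x => by
    rcases lt_or_ge (R₀ + 3) x.opNorm with hx | hx
    · rw [hχ3 N x hx, zero_smul, norm_zero]
      exact mul_nonneg (norm2_nonneg _) hC0
    · rw [norm_smul, Real.norm_eq_abs, abs_of_nonneg (hχ0 N x)]
      exact (mul_le_mul (hχ1 N x) (hpt N x hx) (norm_nonneg _) zero_le_one).trans_eq (one_mul _)
  have hXi : ∀ N, Integrable (fun x => χ N x • tauN N (normGrad (V N) x j * NCP.eval x.mat p))
      (gibbs (V N)) := fun N => by
    refine Integrable.of_bound ((hχs N).continuous.measurable.smul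
      (measurable_tauN_normGrad_mul j p)).aestronglyMeasurable (K * C)
      (Eventually.of_forall fun x => ?_)
    rcases lt_or_ge (R₀ + 3) x.opNorm with hx | hx
    · rw [hχ3 N x hx, zero_smul, norm_zero]
      positivity
    · exact (hXb N x).trans (mul_le_mul_of_nonneg_right (hK N x hx) hC0)
  have hXl : Tendsto (fun N => ∫ x, χ N x • tauN N (normGrad (V N) x j * NCP.eval x.mat p)
      ∂gibbs (V N)) atTop (𝓝 (G lam.toFun)) := by
    have h0 : Tendsto (fun N => ∫ x, χ N x • tauN N (normGrad (V N) x j * NCP.eval x.mat p)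
        ∂gibbs (V N) - ∫ x, χ N x • G x.law ∂gibbs (V N)) atTop (𝓝 0) := by
      refine squeeze_zero_norm' ?_ (tendsto_const_div_atTop_nhds_zero_nat C)
      filter_upwards [eventually_ne_atTop 0] with N hN
      have := norm_integral_cutoff_sub_le hN (hV N) (hZ N) hb.le (hC N) (hχs N) (hχc N) (hχ4 N)
        (hχ3 N) j p hC0 (hCp N)
      simpa only [hGt] using this
    simpa using h0.add hY
  have hlim : ‖P lam.toFun - G lam.toFun‖ₑ ≤ ENNReal.ofReal (C * α) := by
    -- Outside the ball only the χ-term survives. With s = ‖DV_N‖₂ and even moment M, it is at most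
    -- C·s, and s ≤ 1 + s² ≤ 1 + a + b·M ≤ (1 + a + b)(1 + M).
    have hb1 := ENNReal.Tendsto.const_mul (a := ENNReal.ofReal (C * (1 + a + b))) hD
      (Or.inr ENNReal.ofReal_ne_top)
    have hb2 := hb1.const_add (ENNReal.ofReal (C * α))
    rw [mul_zero, add_zero] at hb2
    refine le_of_tendsto_of_tendsto ((hZl.sub hXl).enorm) hb2 ?_
    filter_upwards [eventually_norm2_sub_lt hf] with N hN
    rw [← integral_sub (hZi N) (hXi N)]
    refine (enorm_integral_le_lintegral_enorm _).trans ?_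
    have hbadm : MeasurableSet {x : MatTuple m N | R₀ ≤ x.opNorm} :=
      (isClosed_le continuous_const MatTuple.continuous_opNorm).measurableSet
    rw [← lintegral_const_mul' _ _ ENNReal.ofReal_ne_top, ← lintegral_add_compl _ hbadm, add_comm]
    refine add_le_add ?_ ?_
    · calc _ ≤ ∫⁻ x in {x : MatTuple m N | R₀ ≤ x.opNorm}ᶜ, ENNReal.ofReal (C * α)
            ∂gibbs (V N) := by
            refine setLIntegral_mono' hbadm.compl fun x hx => ?_
            have hx' : x.opNorm < R₀ := by simpa using hx
            rw [← ofReal_norm]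
            refine ENNReal.ofReal_le_ofReal ?_
            rw [hw2 N x hx', hχ2 N x hx'.le, one_smul, one_smul, ← hPt _ x.law_mul_comm,
              ← MatTuple.tauN_evalTrP_mul, ← map_sub, ← sub_mul, ← norm_neg,
              ← map_neg, ← neg_mul, neg_sub, mul_comm C]
            refine (norm_tauN_mul_le _ _).trans (mul_le_mul ?_ (hCp N x (by linarith))
              (norm_nonneg _) hα.le)
            exact (sqrt_tauN_le_norm2 (normGrad (V N) x - x.evalTrP f) j).trans (hN x hx'.le).le
        _ ≤ _ := by
            rw [setLIntegral_const]
            exact mul_le_of_le_one_right zero_le prob_le_one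
    · refine setLIntegral_mono' hbadm fun x hx => ?_
      rw [hw, Set.indicator_of_notMem (by simpa using hx), zero_smul, zero_sub, enorm_neg,
        ← ofReal_norm, ← ENNReal.ofReal_mul (by positivity)]
      refine ENNReal.ofReal_le_ofReal ((hXb N x).trans ?_)
      rw [mul_comm, mul_assoc]
      refine mul_le_mul_of_nonneg_left ?_ hC0
      have h1 := hC N x
      have h2 := x.evenMoment_nonneg n
      have h3 := norm2_nonneg (normGrad (V N) x)
      nlinarith [mul_nonneg ha.le h2]
  rw [hPt _ lam.tracial, hGt]
  rw [← ofReal_norm] at hlim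
  exact (ENNReal.ofReal_le_ofReal_iff (by positivity)).1 hlim

end GibbsLimits

/-! ### The Gelfand–Naimark–Segal construction for a non-commutative law -/

namespace NCLaw

variable {m : ℕ} (lam : NCLaw m)

theorem map_conj_mul_self_nonneg (p : NCP m) : 0 ≤ lam.toFun (NCP.conj p * p) := by
  have h := (lam.completelyPositive 1 1 (Matrix.of fun _ _ => p)).diag_nonneg (i := 0)
  simpa using h

/-- Complete positivity for the row (p, q) gives a positive, hence Hermitian, 2 × 2 matrix; this is
its off-diagonal entry. -/
theorem star_map_conj_mul (p q : NCP m) :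
    (starRingEnd ℂ) (lam.toFun (NCP.conj q * p)) = lam.toFun (NCP.conj p * q) := by
  have h := (lam.completelyPositive 1 2 (Matrix.of fun _ j => ![p, q] j)).isHermitian.apply 0 1
  simpa using h

set_option linter.unusedVariables false in
/-- The polynomials with the semi-inner product `⟨p, q⟩ = λ(p^* q)`. -/
@[nolint unusedArguments]
def PreGNS (lam : NCLaw m) : Type := NCP m

noncomputable instance : AddCommGroup lam.PreGNS := inferInstanceAs (AddCommGroup (NCP m))

noncomputable instance : Module ℂ lam.PreGNS := inferInstanceAs (Module ℂ (NCP m))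

/-- The identity map from polynomials to `PreGNS`. -/
noncomputable def toPreGNS : NCP m ≃ₗ[ℂ] lam.PreGNS := LinearEquiv.refl ℂ _

/-- The semi-inner product `⟨p, q⟩ = λ(p^* q)`. -/
noncomputable abbrev gnsCore : PreInnerProductSpace.Core ℂ lam.PreGNS where
  inner p q := lam.toFun (NCP.conj (lam.toPreGNS.symm p) * lam.toPreGNS.symm q)
  conj_inner_symm p q := lam.star_map_conj_mul _ _
  re_inner_nonneg p :=
    (Complex.nonneg_iff.1 (lam.map_conj_mul_self_nonneg (lam.toPreGNS.symm p))).1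
  add_left p q r := by simp [NCP.conj_add, add_mul]
  smul_left p q c := by simp [NCP.conj_smul]

noncomputable instance : SeminormedAddCommGroup lam.PreGNS :=
  InnerProductSpace.Core.toSeminormedAddCommGroup (c := lam.gnsCore)

noncomputable instance : InnerProductSpace ℂ lam.PreGNS := InnerProductSpace.ofCore lam.gnsCore

/-- The Hilbert space of the Gelfand–Naimark–Segal construction. -/
abbrev GNS : Type := UniformSpace.Completion lam.PreGNS

/-- The vector of a polynomial. -/
noncomputable def vec (p : NCP m) : lam.GNS := ((lam.toPreGNS p : lam.PreGNS) : lam.GNS)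

theorem inner_toPreGNS (p q : NCP m) :
    inner ℂ (lam.toPreGNS p) (lam.toPreGNS q) = lam.toFun (NCP.conj p * q) := rfl

theorem inner_vec (p q : NCP m) : inner ℂ (lam.vec p) (lam.vec q) = lam.toFun (NCP.conj p * q) := by
  rw [vec, vec, UniformSpace.Completion.inner_coe, inner_toPreGNS]

theorem norm_toPreGNS_sq (p : NCP m) :
    ‖lam.toPreGNS p‖ ^ 2 = (lam.toFun (NCP.conj p * p)).re := by
  rw [@norm_sq_eq_re_inner ℂ, inner_toPreGNS]
  rfl

theorem norm_toPreGNS_conj (p : NCP m) : ‖lam.toPreGNS (NCP.conj p)‖ = ‖lam.toPreGNS p‖ := by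
  refine (sq_eq_sq₀ (norm_nonneg _) (norm_nonneg _)).1 ?_
  rw [norm_toPreGNS_sq, norm_toPreGNS_sq, NCP.conj_conj, lam.tracial]

@[elab_as_elim]
theorem gns_induction {P : lam.GNS → Prop} (ξ : lam.GNS) (hc : IsClosed {ξ | P ξ})
    (hv : ∀ p, P (lam.vec p)) : P ξ :=
  UniformSpace.Completion.induction_on ξ hc fun p => hv (lam.toPreGNS.symm p)

/-- The bound `‖X_j p‖₂ ≤ R ‖p‖₂`. -/
def BoundedBy (R : ℝ) : Prop := ∀ (j : Fin m) (p : NCP m),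
  ‖lam.toPreGNS (NCP.var j * p)‖ ≤ R * ‖lam.toPreGNS p‖

/-- The involution is isometric by traciality and exchanges left and right multiplication. -/
theorem norm_mul_var_le {R : ℝ} (h : lam.BoundedBy R) (j : Fin m) (p : NCP m) :
    ‖lam.toPreGNS (p * NCP.var j)‖ ≤ R * ‖lam.toPreGNS p‖ := by
  rw [← norm_toPreGNS_conj, NCP.conj_mul, NCP.conj_var, ← lam.norm_toPreGNS_conj p]
  exact h j _

/-! ### Left and right multiplications, the von Neumann algebra they produce, and its trace. -/

section Operators

variable {lam} {R : ℝ} (h : lam.BoundedBy R)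

/-- The operator of left multiplication by `X_j`. -/
noncomputable def leftMul (j : Fin m) : lam.GNS →L[ℂ] lam.GNS :=
  (LinearMap.mkContinuous (lam.toPreGNS.toLinearMap ∘ₗ LinearMap.mulLeft ℂ (NCP.var j) ∘ₗ
    lam.toPreGNS.symm.toLinearMap) R fun p => h j (lam.toPreGNS.symm p)).completion

/-- The operator of right multiplication by `X_j`. -/
noncomputable def rightMul (j : Fin m) : lam.GNS →L[ℂ] lam.GNS :=
  (LinearMap.mkContinuous (lam.toPreGNS.toLinearMap ∘ₗ LinearMap.mulRight ℂ (NCP.var j) ∘ₗ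
    lam.toPreGNS.symm.toLinearMap) R fun p =>
      lam.norm_mul_var_le h j (lam.toPreGNS.symm p)).completion

variable (lam) in
/-- The conjugate-linear isometry `p ↦ p^*`. -/
noncomputable def modConj : lam.GNS →SL[starRingEnd ℂ] lam.GNS :=
  (LinearMap.mkContinuous (σ := starRingEnd ℂ)
    { toFun := fun p => lam.toPreGNS (NCP.conj (lam.toPreGNS.symm p))
      map_add' := fun p q => by rw [map_add, NCP.conj_add, map_add]
      map_smul' := fun c p => by rw [map_smul, NCP.conj_smul, map_smul]; rfl } 1 fun p => by
    rw [one_mul]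
    exact (lam.norm_toPreGNS_conj (lam.toPreGNS.symm p)).le).completion

theorem leftMul_vec (j : Fin m) (p : NCP m) : leftMul h j (lam.vec p) = lam.vec (NCP.var j * p) :=
  ContinuousLinearMap.completion_apply_coe _ _

theorem rightMul_vec (j : Fin m) (p : NCP m) :
    rightMul h j (lam.vec p) = lam.vec (p * NCP.var j) :=
  ContinuousLinearMap.completion_apply_coe _ _

theorem modConj_vec (p : NCP m) : lam.modConj (lam.vec p) = lam.vec (NCP.conj p) :=
  ContinuousLinearMap.completion_apply_coe _ _

theorem vec_add (p q : NCP m) : lam.vec (p + q) = lam.vec p + lam.vec q := by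
  simp [vec, UniformSpace.Completion.coe_add]

theorem vec_smul (c : ℂ) (p : NCP m) : lam.vec (c • p) = c • lam.vec p := by
  simp [vec, UniformSpace.Completion.coe_smul]

theorem norm_leftMul_le (hR : 0 ≤ R) (j : Fin m) : ‖leftMul h j‖ ≤ R := by
  refine ContinuousLinearMap.opNorm_le_bound _ hR fun ξ => ?_
  refine lam.gns_induction ξ ?_ fun p => ?_
  · exact isClosed_le (by fun_prop) (by fun_prop)
  rw [leftMul_vec, vec, vec, UniformSpace.Completion.norm_coe, UniformSpace.Completion.norm_coe]
  exact h j p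

theorem isSelfAdjoint_leftMul (j : Fin m) : IsSelfAdjoint (leftMul h j) := by
  rw [ContinuousLinearMap.isSelfAdjoint_iff_isSymmetric]
  intro ξ η
  refine lam.gns_induction ξ ?_ fun p => ?_
  · exact isClosed_eq (by fun_prop) (by fun_prop)
  refine lam.gns_induction η ?_ fun q => ?_
  · exact isClosed_eq (by fun_prop) (by fun_prop)
  simp only [ContinuousLinearMap.coe_coe, leftMul_vec, inner_vec, NCP.conj_mul, NCP.conj_var,
    mul_assoc]

theorem leftMul_mul_rightMul (i j : Fin m) :
    leftMul h i * rightMul h j = rightMul h j * leftMul h i := by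
  ext1 ξ
  refine lam.gns_induction ξ ?_ fun p => ?_
  · exact isClosed_eq (by fun_prop) (by fun_prop)
  simp only [mul_apply_eq_comp, leftMul_vec, rightMul_vec, mul_assoc]

/-- Traciality of λ, extended by continuity to all vectors of the completion. -/
theorem inner_modConj_comm (ξ η : lam.GNS) :
    inner ℂ (lam.modConj ξ) η = inner ℂ (lam.modConj η) ξ := by
  refine lam.gns_induction ξ ?_ fun p => ?_
  · exact isClosed_eq (by fun_prop) (by fun_prop)
  refine lam.gns_induction η ?_ fun q => ?_
  · exact isClosed_eq (by fun_prop) (by fun_prop)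
  simp only [modConj_vec, inner_vec, NCP.conj_conj]
  exact lam.tracial p q

/-- Left multiplication by a polynomial. -/
theorem eval_leftMul_vec (p q : NCP m) : NCP.eval (leftMul h) p (lam.vec q) = lam.vec (p * q) := by
  induction p using NCP.induction_var with
  | h1 => simp
  | hv j p hp =>
    rw [map_mul, NCP.eval_var, mul_apply_eq_comp, hp, leftMul_vec, mul_assoc]
  | ha p r hp hr => rw [map_add, add_apply, hp, hr, add_mul, vec_add]
  | hs c p hp => rw [map_smul, smul_apply, hp, smul_mul_assoc, vec_smul]

/-- Right multiplication by a polynomial. -/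
noncomputable def rightMulPoly (p : NCP m) : lam.GNS →L[ℂ] lam.GNS :=
  (NCP.eval (fun j => MulOpposite.op (rightMul h j)) p).unop

theorem rightMulPoly_var_mul (j : Fin m) (p : NCP m) :
    rightMulPoly h (NCP.var j * p) = rightMulPoly h p * rightMul h j := by
  rw [rightMulPoly, map_mul, NCP.eval_var]
  rfl

theorem rightMulPoly_vec (p q : NCP m) : rightMulPoly h p (lam.vec q) = lam.vec (q * p) := by
  induction p using NCP.induction_var generalizing q with
  | h1 => simp [rightMulPoly]
  | hv j p hp =>
    rw [rightMulPoly_var_mul, mul_apply_eq_comp, rightMul_vec, hp, mul_assoc]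
  | ha p r hp hr =>
    rw [mul_add, vec_add, ← hp, ← hr, rightMulPoly, map_add]
    rfl
  | hs c p hp =>
    rw [mul_smul_comm, vec_smul, ← hp, rightMulPoly, map_smul]
    rfl

theorem inner_one_rightMulPoly (p : NCP m) (ξ : lam.GNS) :
    inner ℂ (lam.vec 1) (rightMulPoly h p ξ) = inner ℂ (lam.vec (NCP.conj p)) ξ := by
  refine lam.gns_induction ξ ?_ fun q => ?_
  · exact isClosed_eq (by fun_prop) (by fun_prop)
  rw [rightMulPoly_vec, inner_vec, inner_vec, NCP.conj_one, one_mul, NCP.conj_conj, lam.tracial]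

/-- The commutant of the left multiplications. -/
noncomputable def gnsCommutant : VonNeumannAlgebra lam.GNS where
  toStarSubalgebra := StarSubalgebra.centralizer ℂ (Set.range (leftMul h))
  centralizer_centralizer' := Set.centralizer_centralizer_centralizer _

theorem mem_gnsCommutant {g : lam.GNS →L[ℂ] lam.GNS} :
    g ∈ gnsCommutant h ↔ ∀ j, leftMul h j * g = g * leftMul h j := by
  change g ∈ StarSubalgebra.centralizer ℂ (Set.range (leftMul h)) ↔ _
  rw [StarSubalgebra.mem_centralizer_iff]
  simp [(isSelfAdjoint_leftMul h _).star_eq]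

/-- The von Neumann algebra generated by the left multiplications. -/
noncomputable def gnsAlgebra : VonNeumannAlgebra lam.GNS := (gnsCommutant h).commutant

theorem leftMul_mem_gnsAlgebra (j : Fin m) : leftMul h j ∈ gnsAlgebra h := by
  rw [gnsAlgebra, VonNeumannAlgebra.mem_commutant_iff]
  exact fun g hg => ((mem_gnsCommutant h).1 hg j).symm

/-- Right multiplications commute with left ones, so they lie in the commutant whose commutant is
the algebra. -/
theorem rightMulPoly_mul_comm {a : lam.GNS →L[ℂ] lam.GNS} (ha : a ∈ gnsAlgebra h) (p : NCP m) :
    rightMulPoly h p * a = a * rightMulPoly h p := by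
  induction p using NCP.induction_var with
  | h1 => simp [rightMulPoly]
  | hv j p hp =>
    have hj : rightMul h j * a = a * rightMul h j :=
      VonNeumannAlgebra.mem_commutant_iff.1 ha _
        ((mem_gnsCommutant h).2 fun i => leftMul_mul_rightMul h i j)
    rw [rightMulPoly_var_mul, mul_assoc, hj, ← mul_assoc, hp, mul_assoc]
  | ha p r hp hr =>
    have : rightMulPoly h (p + r) = rightMulPoly h p + rightMulPoly h r := by
      rw [rightMulPoly, map_add]; rfl
    rw [this, add_mul, mul_add, hp, hr]
  | hs c p hp =>
    have : rightMulPoly h (c • p) = c • rightMulPoly h p := by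
      rw [rightMulPoly, map_smul]; rfl
    rw [this, smul_mul_assoc, mul_smul_comm, hp]

/-- For every a in the algebra, not only for polynomials: ⟨a^*1, p⟩ = ⟨1, a R_p 1⟩ = ⟨1, R_p a 1⟩ =
⟨p^*, a1⟩, where R_p is right multiplication by p. No density theorem is needed to see that the
vector state is a trace. -/
theorem star_apply_one {a : lam.GNS →L[ℂ] lam.GNS} (ha : a ∈ gnsAlgebra h) :
    star a (lam.vec 1) = lam.modConj (a (lam.vec 1)) := by
  refine ext_inner_right ℂ fun ξ => ?_
  refine lam.gns_induction ξ ?_ fun p => ?_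
  · exact isClosed_eq (by fun_prop) (by fun_prop)
  rw [ContinuousLinearMap.star_eq_adjoint, ContinuousLinearMap.adjoint_inner_left,
    inner_modConj_comm, modConj_vec, ← inner_one_rightMulPoly h]
  congr 1
  have h1 := DFunLike.congr_fun (rightMulPoly_mul_comm h ha p) (lam.vec 1)
  rw [mul_apply_eq_comp, mul_apply_eq_comp, rightMulPoly_vec, one_mul] at h1
  exact h1.symm

theorem continuous_induced_of_eq {S Y Z : Type*} [TopologicalSpace Y] [TopologicalSpace Z]
    {f : S → Y} {F : Y → Z} {g : S → Z} (hF : Continuous F) (hg : ∀ a, g a = F (f a)) :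
    @Continuous S Z (TopologicalSpace.induced f inferInstance) _ g := by
  have : g = F ∘ f := funext hg
  rw [this]
  let := TopologicalSpace.induced f inferInstance
  exact hF.comp continuous_induced_dom

/-- The vector functional of the unit. -/
noncomputable def gnsFunctional : (gnsAlgebra h).toStarSubalgebra →ₗ[ℂ] ℂ where
  toFun a := inner ℂ (lam.vec 1) (a.1 (lam.vec 1))
  map_add' a b := inner_add_right (lam.vec 1) (a.1 (lam.vec 1)) (b.1 (lam.vec 1))
  map_smul' c a := inner_smul_right (lam.vec 1) (a.1 (lam.vec 1)) c

theorem gnsFunctional_apply (a : (gnsAlgebra h).toStarSubalgebra) :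
    gnsFunctional h a = inner ℂ (lam.vec 1) (a.1 (lam.vec 1)) := rfl

theorem norm_gnsFunctional_le (a : (gnsAlgebra h).toStarSubalgebra) :
    ‖gnsFunctional h a‖ ≤ ‖lam.vec 1‖ * ‖lam.vec 1‖ * ‖a‖ := by
  rw [gnsFunctional_apply]
  refine (norm_inner_le_norm (𝕜 := ℂ) _ _).trans ?_
  rw [mul_assoc]
  refine mul_le_mul_of_nonneg_left ?_ (norm_nonneg _)
  rw [mul_comm]
  exact a.1.le_opNorm _

/-- By `inner_modConj_comm` the right-hand side is symmetric in a and b, which is the trace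
property. -/
theorem gnsFunctional_mul (a b : (gnsAlgebra h).toStarSubalgebra) :
    gnsFunctional h (a * b) = inner ℂ (lam.modConj (a.1 (lam.vec 1))) (b.1 (lam.vec 1)) := by
  rw [← star_apply_one h a.2, ContinuousLinearMap.star_eq_adjoint,
    ContinuousLinearMap.adjoint_inner_left]
  rfl

theorem gnsFunctional_star_mul_self_nonneg (a : (gnsAlgebra h).toStarSubalgebra) :
    0 ≤ gnsFunctional h (star a * a) := by
  have : gnsFunctional h (star a * a) = inner ℂ (a.1 (lam.vec 1)) (a.1 (lam.vec 1)) := by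
    rw [← ContinuousLinearMap.adjoint_inner_right a.1, ← ContinuousLinearMap.star_eq_adjoint]
    rfl
  rw [this, inner_self_eq_norm_sq_to_K]
  norm_cast
  positivity

/-- The vector state of the unit, which is a trace. -/
noncomputable def gnsTrace : VNTrace (gnsAlgebra h) where
  toFun := gnsFunctional h
  bounded := ⟨_, norm_gnsFunctional_le h⟩
  wot_continuous := continuous_induced_of_eq
    (ContinuousLinearMapWOT.continuous_dual_apply (lam.vec 1) (innerSL ℂ (lam.vec 1)))
    fun _ => rfl
  map_one := by
    change inner ℂ (lam.vec 1) (lam.vec 1) = 1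
    rw [inner_vec, NCP.conj_one, one_mul, lam.map_one]
  tracial a b := by rw [gnsFunctional_mul, gnsFunctional_mul, inner_modConj_comm]
  nonneg := gnsFunctional_star_mul_self_nonneg h

/-- The generators of the von Neumann algebra of the law. -/
noncomputable def gnsVar (j : Fin m) : (gnsAlgebra h).toStarSubalgebra :=
  ⟨leftMul h j, leftMul_mem_gnsAlgebra h j⟩

theorem coe_eval_gnsVar (p : NCP m) :
    ((NCP.eval (gnsVar h) p : (gnsAlgebra h).toStarSubalgebra) : lam.GNS →L[ℂ] lam.GNS) =
      NCP.eval (leftMul h) p := by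
  induction p using NCP.induction_var with
  | h1 => simp
  | hv j p hp => rw [map_mul, map_mul, ← hp, NCP.eval_var, NCP.eval_var]; rfl
  | ha p r hp hr => rw [map_add, map_add, ← hp, ← hr]; rfl
  | hs c p hp => rw [map_smul, map_smul, ← hp]; rfl

theorem hasLaw_gnsVar : (gnsTrace h).HasLaw (gnsVar h) lam := by
  refine ⟨fun j => Subtype.ext (isSelfAdjoint_leftMul h j), fun p => ?_⟩
  change gnsFunctional h (NCP.eval (gnsVar h) p) = _
  rw [gnsFunctional_apply, coe_eval_gnsVar, eval_leftMul_vec, inner_vec, NCP.conj_one, one_mul, mul_one]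

/-- If S contains the left multiplications, then S' is contained in their commutant; taking
commutants again puts the algebra inside S'' = S. -/
theorem generates_gnsVar : Generates (gnsVar h) := by
  intro S hS a ha
  rw [← S.commutant_commutant, VonNeumannAlgebra.mem_commutant_iff]
  intro g hg
  refine VonNeumannAlgebra.mem_commutant_iff.1 ha g ((mem_gnsCommutant h).2 fun j => ?_)
  exact VonNeumannAlgebra.mem_commutant_iff.1 hg _ (hS j)

end Operators

theorem exists_realization {R : ℝ} (hR : 0 ≤ R) (h : lam.BoundedBy R) :
    ∃ (H : Type) (_ : NormedAddCommGroup H) (_ : InnerProductSpace ℂ H) (_ : CompleteSpace H)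
      (M : VonNeumannAlgebra H) (τ : VNTrace M) (X : Fin m → M.toStarSubalgebra),
      τ.HasLaw X lam ∧ Generates X ∧ ∀ j, ‖X j‖ ≤ R :=
  ⟨lam.GNS, inferInstance, inferInstance, inferInstance, gnsAlgebra h, gnsTrace h, gnsVar h,
    hasLaw_gnsVar h, generates_gnsVar h, norm_leftMul_le h hR⟩

end NCLaw

open scoped Matrix.Norms.L2Operator in
/-- A law around which random matrices of norm less than `R₀` concentrate is bounded by `R₀`. -/
theorem boundedBy_of_concentratesAround {m : ℕ} {μ : ∀ N, Measure (MatTuple m N)}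
    [∀ N, IsProbabilityMeasure (μ N)] {lam : NCLaw m} {R₀ : ℝ} (hR₀ : 0 ≤ R₀)
    (hA : ConcentratesAround μ lam)
    (hR : Tendsto (fun N => μ N {x | R₀ ≤ x.opNorm}) atTop (𝓝 0)) : lam.BoundedBy R₀ := by
  intro j p
  refine (sq_le_sq₀ (norm_nonneg _) (mul_nonneg hR₀ (norm_nonneg _))).1 ?_
  rw [mul_pow, NCLaw.norm_toPreGNS_sq, NCLaw.norm_toPreGNS_sq, ← sub_nonneg]
  -- The condition involves two moments only, so it is closed in the law; for matrices it is
  -- `hsSq_mul_le`.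
  have hG : Continuous fun φ : NCP m → ℂ => R₀ ^ 2 * (φ (NCP.conj p * p)).re -
      (φ (NCP.conj (NCP.var j * p) * (NCP.var j * p))).re := by
    have h := fun q : NCP m => Complex.continuous_re.comp (continuous_apply (A := fun _ => ℂ) q)
    exact (continuous_const.mul (h _)).sub (h _)
  refine mem_of_forall_law_mem hA hR hG isClosed_Ici fun N x hx => ?_
  change (0 : ℝ) ≤ _ - _
  rw [sub_nonneg]
  have h : ∀ q : NCP m, (x.law (NCP.conj q * q)).re = (N : ℝ)⁻¹ * hsSq (NCP.eval x.mat q) :=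
    fun q => by
      rw [MatTuple.law_apply, map_mul, NCP.eval_conj x.star_mat, Matrix.star_eq_conjTranspose,
        tauN_conjTranspose_mul_self, Complex.ofReal_re]
  rw [h, h, map_mul, NCP.eval_var, mul_left_comm]
  refine mul_le_mul_of_nonneg_left ((hsSq_mul_le _ _).trans ?_) (by positivity)
  have h1 := (MatTuple.norm_mat_le x j).trans hx.le
  have h2 := hsSq_nonneg (NCP.eval x.mat p)
  exact mul_le_mul_of_nonneg_right (pow_le_pow_left₀ (norm_nonneg _) h1 2) h2

/-! ### Trace polynomials in a tracial von Neumann algebra -/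

namespace VNTrace

variable {H : Type*} [NormedAddCommGroup H] [InnerProductSpace ℂ H] [CompleteSpace H]
  {M : VonNeumannAlgebra H} {τ : VNTrace M} {m : ℕ} {X : Fin m → M.toStarSubalgebra}
  {lam : NCLaw m}

theorem toL2_sub (a b : M.toStarSubalgebra) : τ.toL2 (a - b) = τ.toL2 a - τ.toL2 b := by
  simp [toL2, UniformSpace.Completion.coe_sub]

theorem norm_toL2_sq (a : M.toStarSubalgebra) : ‖τ.toL2 a‖ ^ 2 = (τ.toFun (star a * a)).re := by
  rw [toL2, UniformSpace.Completion.norm_coe, @norm_sq_eq_re_inner ℂ]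
  rfl

theorem HasLaw.eval_conj (h : τ.HasLaw X lam) (p : NCP m) :
    NCP.eval X (NCP.conj p) = star (NCP.eval X p) := NCP.eval_conj (fun j => h.1 j) p

theorem HasLaw.evalTrP_eq (h : τ.HasLaw X lam) (f : TrP1 m) :
    τ.evalTrP X f = NCP.eval X (TrP1.reduce lam.toFun lam.tracial f) :=
  TrP1.eval_eq_reduce _ _ _ _ h.2 _

theorem HasLaw.sum_norm_toL2_sq (h : τ.HasLaw X lam) (f : Fin m → TrP1 m) :
    ∑ j, ‖τ.toL2 (τ.evalTrP X (f j))‖ ^ 2 = lam.normSq f := by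
  refine Finset.sum_congr rfl fun j _ => ?_
  rw [norm_toL2_sq, h.evalTrP_eq, ← h.eval_conj, ← map_mul (NCP.eval X), h.2]

theorem HasLaw.mulTrace_eval (h : τ.HasLaw X lam) (f : TrP1 m) (p : NCP m) :
    τ.mulTrace (τ.toL2 (τ.evalTrP X f)) (NCP.eval X p) =
      lam.toFun (TrP1.reduce lam.toFun lam.tracial f * p) := by
  rw [mulTrace_toL2, h.evalTrP_eq, ← map_mul (NCP.eval X), h.2]

theorem HasLaw.isConjugateVariable_iff (h : τ.HasLaw X lam) (ξ : Fin m → τ.L2) :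
    τ.IsConjugateVariable X ξ ↔ ∀ j p, τ.mulTrace (ξ j) (NCP.eval X p) =
      NCP.tensorSq lam.toFun (NCP.diff j p) := by
  have : τ.toFun ∘ₗ (NCP.eval X).toLinearMap = lam.toFun := LinearMap.ext h.2
  rw [IsConjugateVariable, this]

/-- A conjugate variable in the closure of the polynomials has minimal norm. -/
theorem HasLaw.norm_le_of_isConjugateVariable (h : τ.HasLaw X lam) {ξ ξ' : Fin m → τ.L2}
    (hξ : τ.IsConjugateVariable X ξ) (hξ' : τ.IsConjugateVariable X ξ') {j : Fin m}
    {q : ℕ → NCP m} (hq : Tendsto (fun k => τ.toL2 (NCP.eval X (q k))) atTop (𝓝 (ξ j))) :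
    ‖ξ j‖ ≤ ‖ξ' j‖ := by
  -- Two solutions of the relation have the same pairing with every polynomial, so their difference
  -- is orthogonal to the polynomials and therefore to ξ j.
  have h0 : ∀ p, inner ℂ (τ.toL2 (NCP.eval X p)) (ξ' j - ξ j) = 0 := fun p => by
    have h1 := (hξ' j (NCP.conj p)).trans (hξ j (NCP.conj p)).symm
    rw [mulTrace, mulTrace, h.eval_conj, star_star] at h1
    rw [inner_sub_right, h1, sub_self]
  have h1 : inner ℂ (ξ j) (ξ' j - ξ j) = 0 := by
    refine tendsto_nhds_unique (hq.inner tendsto_const_nhds) ?_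
    simp only [h0]
    exact tendsto_const_nhds
  rw [inner_sub_right, sub_eq_zero] at h1
  have h2 : ‖ξ j‖ * ‖ξ j‖ ≤ ‖ξ j‖ * ‖ξ' j‖ := by
    rw [← inner_self_eq_norm_mul_norm (𝕜 := ℂ), ← h1]
    exact re_inner_le_norm _ _
  rcases (norm_nonneg (ξ j)).eq_or_lt with h3 | h3
  · rw [← h3]; exact norm_nonneg _
  · exact le_of_mul_le_mul_left h2 h3

end VNTrace

/-! ### Convergence to the conjugate variable -/

section Convergence

variable {H : Type*} [NormedAddCommGroup H] [InnerProductSpace ℂ H] [CompleteSpace H]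
  {M : VonNeumannAlgebra H} {τ : VNTrace M} {m : ℕ} {X : Fin m → M.toStarSubalgebra}
  {lam : NCLaw m} {φ : ∀ N, MatTuple m N → Fin m → Matrix (Fin N) (Fin N) ℂ} {R₀ : ℝ}

theorem norm_toL2_sub_le (hX : τ.HasLaw X lam)
    (hφ : ∀ (f g : Fin m → TrP1 m) (α β : ℝ), approxError φ f R₀ < ENNReal.ofReal α →
      approxError φ g R₀ < ENNReal.ofReal β → lam.normSq (f - g) ≤ (α + β) ^ 2)
    {f g : Fin m → TrP1 m} {α β : ℝ} (hα : 0 ≤ α) (hβ : 0 ≤ β)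
    (hf : approxError φ f R₀ < ENNReal.ofReal α) (hg : approxError φ g R₀ < ENNReal.ofReal β)
    (j : Fin m) : ‖τ.toL2 (τ.evalTrP X (f j)) - τ.toL2 (τ.evalTrP X (g j))‖ ≤ α + β := by
  refine (sq_le_sq₀ (norm_nonneg _) (add_nonneg hα hβ)).1 ?_
  have h1 : τ.toL2 (τ.evalTrP X (f j)) - τ.toL2 (τ.evalTrP X (g j)) =
      τ.toL2 (τ.evalTrP X ((f - g) j)) := by
    rw [← VNTrace.toL2_sub, VNTrace.evalTrP, VNTrace.evalTrP, VNTrace.evalTrP, Pi.sub_apply,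
      map_sub]
  rw [h1]
  refine le_trans ?_ (hφ f g α β hf hg)
  rw [← hX.sum_norm_toL2_sq]
  exact Finset.single_le_sum (f := fun j => ‖τ.toL2 (τ.evalTrP X ((f - g) j))‖ ^ 2)
    (fun _ _ => sq_nonneg _) (Finset.mem_univ j)

/-- The estimate `hφ` bounds the distance of two approximants by the sum of their errors, so f₀ is
Cauchy and all approximating sequences share one limit. The approximate relation `hφ'` becomes exact
in that limit. -/
theorem exists_isConjugateVariable_tendsto (hX : τ.HasLaw X lam)
    (hφ : ∀ (f g : Fin m → TrP1 m) (α β : ℝ), approxError φ f R₀ < ENNReal.ofReal α →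
      approxError φ g R₀ < ENNReal.ofReal β → lam.normSq (f - g) ≤ (α + β) ^ 2)
    (hφ' : ∀ (j : Fin m) (p : NCP m), ∃ C : ℝ, 0 ≤ C ∧ ∀ (f : Fin m → TrP1 m) (α : ℝ), 0 < α →
      approxError φ f R₀ < ENNReal.ofReal α →
      ‖lam.toFun (TrP1.reduce lam.toFun lam.tracial (f j) * p) -
        NCP.tensorSq lam.toFun (NCP.diff j p)‖ ≤ C * α)
    {f₀ : ℕ → Fin m → TrP1 m} (hf₀ : Tendsto (fun k => approxError φ (f₀ k) R₀) atTop (𝓝 0)) :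
    ∃ ξ : Fin m → τ.L2, τ.IsConjugateVariable X ξ ∧
      ∀ f : ℕ → Fin m → TrP1 m, Tendsto (fun k => approxError φ (f k) R₀) atTop (𝓝 0) →
        ∀ j, Tendsto (fun k => τ.toL2 (τ.evalTrP X (f k j))) atTop (𝓝 (ξ j)) := by
  have hc : ∀ j, CauchySeq fun k => τ.toL2 (τ.evalTrP X (f₀ k j)) := fun j => by
    refine Metric.cauchySeq_iff'.2 fun ε hε => ?_
    obtain ⟨k₀, hk₀⟩ := eventually_atTop.1
      (hf₀.eventually_lt_const (ENNReal.ofReal_pos.2 (show 0 < ε / 3 by positivity)))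
    refine ⟨k₀, fun k hk => ?_⟩
    rw [dist_eq_norm]
    have := norm_toL2_sub_le hX hφ (by positivity) (by positivity) (hk₀ k hk) (hk₀ k₀ le_rfl) j
    linarith
  choose ξ hξ using fun j => cauchySeq_tendsto_of_complete (hc j)
  have hconv : ∀ f : ℕ → Fin m → TrP1 m,
      Tendsto (fun k => approxError φ (f k) R₀) atTop (𝓝 0) →
        ∀ j, Tendsto (fun k => τ.toL2 (τ.evalTrP X (f k j))) atTop (𝓝 (ξ j)) := fun f hf j => by
    have h0 : Tendsto (fun k => τ.toL2 (τ.evalTrP X (f k j)) - τ.toL2 (τ.evalTrP X (f₀ k j)))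
        atTop (𝓝 0) := by
      refine Metric.tendsto_nhds.2 fun ε hε => ?_
      have hε' : 0 < ENNReal.ofReal (ε / 3) := ENNReal.ofReal_pos.2 (by positivity)
      filter_upwards [hf.eventually_lt_const hε', hf₀.eventually_lt_const hε'] with k h1 h2
      rw [dist_zero_right]
      have := norm_toL2_sub_le hX hφ (by positivity) (by positivity) h1 h2 j
      linarith
    simpa using h0.add (hξ j)
  refine ⟨ξ, (hX.isConjugateVariable_iff ξ).2 fun j p => ?_, hconv⟩
  have h1 : Tendsto (fun k => τ.mulTrace (τ.toL2 (τ.evalTrP X (f₀ k j))) (NCP.eval X p)) atTop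
      (𝓝 (τ.mulTrace (ξ j) (NCP.eval X p))) := tendsto_const_nhds.inner (hξ j)
  refine tendsto_nhds_unique h1 (Metric.tendsto_nhds.2 fun ε hε => ?_)
  obtain ⟨C, hC0, hC⟩ := hφ' j p
  -- The denominator C + 1 keeps C·α < ε valid also when C = 0.
  have hα : 0 < ε / (C + 1) := by positivity
  filter_upwards [hf₀.eventually_lt_const (ENNReal.ofReal_pos.2 hα)] with k hk
  rw [hX.mulTrace_eval, dist_eq_norm]
  refine (hC _ _ hα hk).trans_lt ?_
  rw [← mul_div_assoc, div_lt_iff₀ (by positivity)]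
  linarith

theorem exists_approxError_tendsto_zero (hB : AsympApproxByTrP φ) (hR₀ : 0 < R₀) :
    ∃ f : ℕ → Fin m → TrP1 m, Tendsto (fun k => approxError φ (f k) R₀) atTop (𝓝 0) := by
  choose f hf using fun k : ℕ => hB (1 / ((k : ℝ) + 1)) Nat.one_div_pos_of_nat R₀ hR₀
  refine ⟨f, tendsto_of_tendsto_of_tendsto_of_le_of_le tendsto_const_nhds ?_ (fun _ => zero_le) hf⟩
  have := ENNReal.tendsto_ofReal (tendsto_one_div_add_atTop_nhds_zero_nat (𝕜 := ℝ))
  rwa [ENNReal.ofReal_zero] at this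

theorem VNTrace.HasLaw.tendsto_normSq (hX : τ.HasLaw X lam) {ξ : Fin m → τ.L2}
    {f : ℕ → Fin m → TrP1 m}
    (h : ∀ j, Tendsto (fun k => τ.toL2 (τ.evalTrP X (f k j))) atTop (𝓝 (ξ j))) :
    Tendsto (fun k => lam.normSq (f k)) atTop (𝓝 (∑ j, ‖ξ j‖ ^ 2)) := by
  simp only [← hX.sum_norm_toL2_sq]
  exact tendsto_finsetSum _ fun j _ => (h j).norm.pow 2

/-- The number Φ is computed from λ alone, so it is the same in every realization. One realization
gives the upper bound; for the lower bound, in each realization the limit of the approximants is a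
solution of minimal norm, componentwise. -/
theorem freeFisherInfo_eq_of_tendsto
    (hφ : ∀ (f g : Fin m → TrP1 m) (α β : ℝ), approxError φ f R₀ < ENNReal.ofReal α →
      approxError φ g R₀ < ENNReal.ofReal β → lam.normSq (f - g) ≤ (α + β) ^ 2)
    (hφ' : ∀ (j : Fin m) (p : NCP m), ∃ C : ℝ, 0 ≤ C ∧ ∀ (f : Fin m → TrP1 m) (α : ℝ), 0 < α →
      approxError φ f R₀ < ENNReal.ofReal α →
      ‖lam.toFun (TrP1.reduce lam.toFun lam.tracial (f j) * p) -
        NCP.tensorSq lam.toFun (NCP.diff j p)‖ ≤ C * α)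
    {f₀ : ℕ → Fin m → TrP1 m} (hf₀ : Tendsto (fun k => approxError φ (f₀ k) R₀) atTop (𝓝 0))
    (hreal : ∃ (H : Type) (_ : NormedAddCommGroup H) (_ : InnerProductSpace ℂ H)
      (_ : CompleteSpace H) (M : VonNeumannAlgebra H) (τ : VNTrace M)
      (X : Fin m → M.toStarSubalgebra), τ.HasLaw X lam ∧ Generates X)
    {Φ : ℝ} (hΦ : Tendsto (fun k => lam.normSq (f₀ k)) atTop (𝓝 Φ)) :
    freeFisherInfo lam = ENNReal.ofReal Φ := by
  refine le_antisymm (sInf_le ?_) (le_sInf ?_)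
  · obtain ⟨H, i₁, i₂, i₃, M, τ, X, hX, hg⟩ := hreal
    obtain ⟨ξ, hξ, hl⟩ := exists_isConjugateVariable_tendsto hX hφ hφ' hf₀
    refine ⟨H, i₁, i₂, i₃, M, τ, X, ξ, hX, hg, hξ, ?_⟩
    rw [tendsto_nhds_unique hΦ (hX.tendsto_normSq (hl f₀ hf₀))]
  · rintro _ ⟨H, i₁, i₂, i₃, M, τ, X, ξ', hX, hg, hξ', rfl⟩
    obtain ⟨ξ, hξ, hl⟩ := exists_isConjugateVariable_tendsto hX hφ hφ' hf₀
    rw [tendsto_nhds_unique hΦ (hX.tendsto_normSq (hl f₀ hf₀))]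
    refine ENNReal.ofReal_le_ofReal (Finset.sum_le_sum fun j _ => ?_)
    refine pow_le_pow_left₀ (norm_nonneg _) ?_ 2
    refine hX.norm_le_of_isConjugateVariable hξ hξ'
      (q := fun k => TrP1.reduce lam.toFun lam.tracial (f₀ k j)) ?_
    simpa only [← hX.evalTrP_eq] using hl f₀ hf₀ j

end Convergence

end FreeFisher

open FreeFisher in
theorem mainTheorem5 {m : ℕ} (V : ∀ N : ℕ, MatTuple m N → ℝ)
    (hV : ∀ N, Differentiable ℝ (V N))
    (hZ : ∀ N, Integrable (fun x : MatTuple m N => Real.exp (-(N : ℝ) ^ 2 * V N x)) volume)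
    (lam : NCLaw m)
    (hA : ConcentratesAround (fun N => gibbs (V N)) lam)
    (hB : AsympApproxByTrP fun N => normGrad (V N))
    (n : ℕ) (a b : ℝ) (ha : 0 < a) (hb : 0 < b)
    (hC : ∀ N (x : MatTuple m N), norm2 (normGrad (V N) x) ^ 2 ≤ a + b * x.evenMoment n)
    (R₀ : ℝ) (hR₀ : 0 < R₀)
    (hD : Tendsto (fun N => ∫⁻ x in {x : MatTuple m N | R₀ ≤ x.opNorm},
      ENNReal.ofReal (1 + x.evenMoment n) ∂(gibbs (V N))) atTop (𝓝 0)) :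
    -- `lam` is realized by self-adjoint operators of norm at most `R₀`
    (∃ (H : Type) (_ : NormedAddCommGroup H) (_ : InnerProductSpace ℂ H) (_ : CompleteSpace H)
      (M : VonNeumannAlgebra H) (τ : VNTrace M) (X : Fin m → M.toStarSubalgebra),
      τ.HasLaw X lam ∧ Generates X ∧ ∀ j, ‖X j‖ ≤ R₀) ∧
    -- approximating sequences exist
    (∃ f : ℕ → Fin m → TrP1 m,
      Tendsto (fun k => approxError (fun N => normGrad (V N)) (f k) R₀) atTop (𝓝 0)) ∧
    -- for every realization, every approximating sequence converges to the conjugate variable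
    (∀ (H : Type*) [NormedAddCommGroup H] [InnerProductSpace ℂ H] [CompleteSpace H]
      (M : VonNeumannAlgebra H) (τ : VNTrace M) (X : Fin m → M.toStarSubalgebra),
      τ.HasLaw X lam → Generates X →
      ∃ ξ : Fin m → τ.L2, τ.IsConjugateVariable X ξ ∧
        freeFisherInfo lam = ENNReal.ofReal (∑ j, ‖ξ j‖ ^ 2) ∧
        ∀ f : ℕ → Fin m → TrP1 m,
          Tendsto (fun k => approxError (fun N => normGrad (V N)) (f k) R₀) atTop (𝓝 0) →
          ∀ j, Tendsto (fun k => τ.toL2 (τ.evalTrP X (f k j))) atTop (𝓝 (ξ j))) ∧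
    -- the free Fisher information is finite and is the limit of the normalized classical one
    freeFisherInfo lam < ⊤ ∧
    Tendsto (fun N : ℕ => ((N : ℝ≥0∞) ^ 3)⁻¹ * fisherInfo (gibbs (V N))) atTop
      (𝓝 (freeFisherInfo lam)) := by
  have hP := fun N => isProbabilityMeasure_gibbs (hZ N)
  have hR := tendsto_gibbs_norm_ge hD
  obtain ⟨f₀, hf₀⟩ := exists_approxError_tendsto_zero hB hR₀
  have hφ := fun (f g : Fin m → TrP1 m) (α β : ℝ)
    (hf : approxError (fun N => normGrad (V N)) f R₀ < ENNReal.ofReal α)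
    (hg : approxError (fun N => normGrad (V N)) g R₀ < ENNReal.ofReal β) =>
    normSq_sub_le hA hR hf hg
  have hφ' := norm_pairing_sub_tensorSq_le hb ha hV hZ hA hC hD
  have hreal := lam.exists_realization hR₀.le (boundedBy_of_concentratesAround hR₀.le hA hR)
  obtain ⟨H₁, i₁, i₂, i₃, M₁, τ₁, X₁, hX₁, hg₁, hn₁⟩ := hreal
  -- The value is read off from `lam.normSq`, which knows only the law, so it also applies to
  -- realizations living in another universe.
  have hΦ : ∀ {Φ : ℝ}, Tendsto (fun k => lam.normSq (f₀ k)) atTop (𝓝 Φ) →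
      freeFisherInfo lam = ENNReal.ofReal Φ := fun hΦ =>
    freeFisherInfo_eq_of_tendsto hφ hφ' hf₀ ⟨H₁, i₁, i₂, i₃, M₁, τ₁, X₁, hX₁, hg₁⟩ hΦ
  obtain ⟨ξ₁, hξ₁, hl₁⟩ := exists_isConjugateVariable_tendsto hX₁ hφ hφ' hf₀
  have hlim := hX₁.tendsto_normSq (hl₁ f₀ hf₀)
  refine ⟨⟨H₁, i₁, i₂, i₃, M₁, τ₁, X₁, hX₁, hg₁, hn₁⟩, ⟨f₀, hf₀⟩, ?_, ?_, ?_⟩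
  · intro H _ _ _ M τ X hX _
    obtain ⟨ξ, hξ, hl⟩ := exists_isConjugateVariable_tendsto hX hφ hφ' hf₀
    exact ⟨ξ, hξ, hΦ (hX.tendsto_normSq (hl f₀ hf₀)), hl⟩
  · rw [hΦ hlim]
    exact ENNReal.ofReal_lt_top
  · rw [hΦ hlim]
    have h := tendsto_lintegral_norm2_sq hb ha hZ hA hC hD hf₀ hlim
    refine h.congr' ?_
    -- Convergence to a finite limit makes the integrals finite for large N, as `fisherInfo_gibbs`
    -- demands; N ≠ 0 makes N³ invertible.
    filter_upwards [h.eventually_lt_const ENNReal.ofReal_lt_top, eventually_ne_atTop 0] with N hN h0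
    exact (fisherInfo_gibbs (hV N) (hZ N) hb.le h0 (hC N) hN.ne).symm
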